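/- Let $G$ be a group that is mixed identity free (MIF): if $w\in\mathbb Z*G=\langle t\rangle * G$ evaluates to $1$ for every substitution $t\mapsto g\in G$, then $w=1$. Let $LG\subset B(\ell^2(G))$ be the group von Neumann algebra of $G$, i.e. the double commutant of the left regular representation, with its natural trace $\tau(x)=\langle x\delta_1,\delta_1\rangle$ and 2-norm $\|x\|_2=\tau(x^*x)^{1/2}$. Let $\mathrm U(LG)$ be its unitary group, $\mathrm{PU}(LG)=\mathrm U(LG)/S^1$ its projective unitary group, $\ell(u)=\|1-u\|_2$ for $u\in \mathrm U(LG)$, and $\bar\ell(u)=\inf_{|\lambda|=1}\|\lambda-u\|_2$, which is well defined on $\mathrm{PU}(LG)$. The group $\mathrm{PU}(LG)$ carries the metric $d(u,v)=\bar\ell(u^{-1}v)$, and $G$ maps to $\mathrm{PU}(LG)$ by the left regular representation. Then: 1. For every $u\in \mathrm{PU}(LG)$ with $0<\bar\ell(u)<1/\sqrt2$, the subgroup $\langle u,G\rangle$ of $\mathrm{PU}(LG)$ is not discrete. 2. The set of discrete subgroups of $\mathrm{PU}(LG)$ containing $G$ is uniformly discrete: there is $\varepsilon>0$ such that no discrete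 subgroup $\Gamma\subset\mathrm{PU}(LG)$ containing $G$ has an element $x\neq 1$ with $\bar\ell(x)<\varepsilon$. 3. For every $u\in \mathrm U(LG)$ that is not a scalar and satisfies $\Re\tau(u)>3/4$, and for every $\varepsilon>0$, there are a word $w$ in the free group $\mathbb F_2$ and an element $g\in G$ such that $w(u,g)\in\mathrm U(LG)$ is not a scalar and $\ell(w(u,g))<\varepsilon$. -/

import Mathlib

noncomputable section

namespace GroupVN

/-! ### Mixed identities -/

/-- Evaluation of a word `w ∈ ℤ ∗ G` at `g ∈ G`: the generator of `ℤ` is sent to `g`, and the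
coefficients in `G` are sent to themselves. -/
def mixedEval {G : Type*} [Group G] (g : G) : Monoid.Coprod (Multiplicative ℤ) G →* G :=
  Monoid.Coprod.lift (zpowersHom G g) (MonoidHom.id G)

/-- `w` is a mixed identity for `G` if it evaluates to `1` at every element of `G`. -/
def IsMixedIdentity {G : Type*} [Group G] (w : Monoid.Coprod (Multiplicative ℤ) G) : Prop :=
  ∀ g : G, mixedEval g w = 1

/-- `G` is mixed identity free if its only mixed identity is the trivial one. -/
def IsMIF (G : Type*) [Group G] : Prop :=
  ∀ w : Monoid.Coprod (Multiplicative ℤ) G, IsMixedIdentity w → w = 1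

/-! ### The group von Neumann algebra -/

/-- The Hilbert space `ℓ²(G)`. -/
abbrev Ell2 (G : Type*) : Type _ := lp (fun _ : G => ℂ) 2

theorem memℓp_translate {G : Type*} [Group G] (g : G) (f : Ell2 G) :
    Memℓp (fun x : G => (f : ∀ _ : G, ℂ) (g⁻¹ * x)) 2 := by
  have h := (lp.memℓp f).summable (by norm_num)
  exact memℓp_gen ((Equiv.mulLeft g⁻¹).summable_iff.mpr h)

/-- Left translation `(λ_g f)(x) = f(g⁻¹ x)` on `ℓ²(G)`, as a linear isometry. -/
def translate {G : Type*} [Group G] (g : G) : Ell2 G →ₗᵢ[ℂ] Ell2 G where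
  toFun f := ⟨fun x => (f : ∀ _ : G, ℂ) (g⁻¹ * x), memℓp_translate g f⟩
  map_add' f₁ f₂ := by ext x; rfl
  map_smul' c f := by ext x; simp
  norm_map' f := by
    rw [lp.norm_eq_tsum_rpow (by norm_num), lp.norm_eq_tsum_rpow (by norm_num)]
    congr 1
    exact (Equiv.mulLeft g⁻¹).tsum_eq (fun x => ‖(f : ∀ _ : G, ℂ) x‖ ^ ENNReal.toReal 2)

@[simp]
theorem translate_apply {G : Type*} [Group G] (g : G) (f : Ell2 G) (x : G) :
    (translate g f : ∀ _ : G, ℂ) x = (f : ∀ _ : G, ℂ) (g⁻¹ * x) := rfl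

/-- The left regular representation of `G` on `ℓ²(G)` by bounded operators. -/
def leftRegular (G : Type*) [Group G] : G →* (Ell2 G →L[ℂ] Ell2 G) where
  toFun g := (translate g).toContinuousLinearMap
  map_one' := by ext f x; simp
  map_mul' g h := by ext f x; simp [mul_assoc]

theorem leftRegular_apply {G : Type*} [Group G] (g : G) (f : Ell2 G) :
    leftRegular G g f = translate g f := rfl

theorem star_leftRegular {G : Type*} [Group G] (g : G) :
    star (leftRegular G g) = leftRegular G g⁻¹ := by
  rw [ContinuousLinearMap.star_eq_adjoint, eq_comm, ContinuousLinearMap.eq_adjoint_iff]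
  intro x y
  rw [leftRegular_apply, leftRegular_apply, ← (translate g).inner_map_map]
  congr 1
  ext z
  simp

/-- The group von Neumann algebra of `G`: the double commutant of the left regular
representation on `ℓ²(G)`. -/
def groupVonNeumannAlgebra (G : Type*) [Group G] : VonNeumannAlgebra (Ell2 G) where
  toStarSubalgebra := StarSubalgebra.centralizer ℂ
    (StarSubalgebra.centralizer ℂ (Set.range (leftRegular G)) : Set (Ell2 G →L[ℂ] Ell2 G))
  centralizer_centralizer' := by simp

/-- `LG`, the group von Neumann algebra, as a type (a unital `*`-algebra over `ℂ`). -/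
abbrev LG (G : Type*) [Group G] : Type _ := ↥(groupVonNeumannAlgebra G).toStarSubalgebra

theorem leftRegular_mem {G : Type*} [Group G] (g : G) :
    leftRegular G g ∈ (groupVonNeumannAlgebra G).toStarSubalgebra := by
  change _ ∈ StarSubalgebra.centralizer ℂ _
  rw [StarSubalgebra.mem_centralizer_iff]
  intro a ha
  have ha' := ha
  rw [SetLike.mem_coe] at ha'
  have ha2 := star_mem ha'
  rw [StarSubalgebra.mem_centralizer_iff] at ha' ha2
  exact ⟨(ha' _ ⟨g, rfl⟩).1.symm, (ha2 _ ⟨g, rfl⟩).1.symm⟩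

/-- The group element `g`, as a unitary of `LG`. -/
def groupUnitary (G : Type*) [Group G] : G →* unitary (LG G) where
  toFun g := ⟨⟨leftRegular G g, leftRegular_mem g⟩, by
    rw [Unitary.mem_iff]
    constructor
    · apply Subtype.ext
      change star (leftRegular G g) * leftRegular G g = 1
      rw [star_leftRegular, ← map_mul, inv_mul_cancel, map_one]
    · apply Subtype.ext
      change leftRegular G g * star (leftRegular G g) = 1
      rw [star_leftRegular, ← map_mul, mul_inv_cancel, map_one]⟩
  map_one' := Subtype.ext (Subtype.ext (map_one _))
  map_mul' g h := Subtype.ext (Subtype.ext (map_mul _ g h))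

/-! ### The trace, the 2-norm and the length functions -/

open Classical in
/-- The unit vector `δ_1 ∈ ℓ²(G)`. -/
def delta (G : Type*) [Group G] : Ell2 G := lp.single 2 (1 : G) (1 : ℂ)

/-- The natural trace `τ(x) = ⟨x δ_1, δ_1⟩` on `LG` (Mathlib's inner product is linear in the
second variable). -/
def trace {G : Type*} [Group G] (x : LG G) : ℂ :=
  inner ℂ (delta G) ((x : Ell2 G →L[ℂ] Ell2 G) (delta G))

/-- The 2-norm `‖x‖₂ = τ(x* x)^{1/2}`. -/
def twoNorm {G : Type*} [Group G] (x : LG G) : ℝ := √(trace (star x * x)).re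

/-- The length function `ℓ(u) = ‖1 - u‖₂` on `U(LG)`. -/
def length {G : Type*} [Group G] (u : unitary (LG G)) : ℝ := twoNorm (1 - (u : LG G))

/-- The projective length function on `U(LG)`, the infimum of `‖z - u‖₂` over `|z| = 1`. -/
def preProjLength {G : Type*} [Group G] (u : unitary (LG G)) : ℝ :=
  ⨅ z : Circle, twoNorm (algebraMap ℂ (LG G) z - (u : LG G))

/-! ### The projective unitary group -/

/-- The scalar unitaries, as a homomorphism `S¹ → U(LG)`. -/
def scalarHom (G : Type*) [Group G] : Circle →* unitary (LG G) where
  toFun z := ⟨algebraMap ℂ (LG G) z, by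
    have h : star (z : ℂ) * z = 1 := by
      rw [Complex.star_def, ← Circle.coe_inv_eq_conj, ← Circle.coe_mul, inv_mul_cancel,
        Circle.coe_one]
    rw [Unitary.mem_iff, ← algebraMap_star_comm, ← map_mul, ← map_mul, mul_comm (z : ℂ), h,
      map_one]
    exact ⟨rfl, rfl⟩⟩
  map_one' := Subtype.ext (by simp)
  map_mul' z w := Subtype.ext (by simp)

theorem scalarHom_commute {G : Type*} [Group G] (z : Circle) (u : unitary (LG G)) :
    scalarHom G z * u = u * scalarHom G z :=
  Subtype.ext (Algebra.commutes (z : ℂ) (u : LG G))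

/-- The subgroup `S¹ · 1` of `U(LG)`. -/
def scalars (G : Type*) [Group G] : Subgroup (unitary (LG G)) := (scalarHom G).range

instance scalars_normal (G : Type*) [Group G] : (scalars G).Normal where
  conj_mem := by
    rintro _ ⟨z, rfl⟩ u
    rw [← scalarHom_commute, mul_inv_cancel_right]
    exact ⟨z, rfl⟩

/-- The projective unitary group `PU(LG) = U(LG) / S¹`. -/
def PU (G : Type*) [Group G] : Type _ := unitary (LG G) ⧸ scalars G

instance (G : Type*) [Group G] : Group (PU G) :=
  inferInstanceAs (Group (unitary (LG G) ⧸ scalars G))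

/-- The quotient homomorphism `U(LG) → PU(LG)`. -/
def toPU (G : Type*) [Group G] : unitary (LG G) →* PU G := QuotientGroup.mk' (scalars G)

/-- The natural homomorphism `G → PU(LG)` given by the left regular representation. -/
def groupToPU (G : Type*) [Group G] : G →* PU G := (toPU G).comp (groupUnitary G)

/-! ### The metric on the projective unitary group -/

theorem twoNorm_eq {G : Type*} [Group G] (x : LG G) :
    twoNorm x = ‖(x : Ell2 G →L[ℂ] Ell2 G) (delta G)‖ := by
  rw [twoNorm, trace]
  change √(inner ℂ (delta G) ((star (x : Ell2 G →L[ℂ] Ell2 G)) ((x : Ell2 G →L[ℂ] Ell2 G)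
    (delta G)))).re = _
  rw [ContinuousLinearMap.star_eq_adjoint, ContinuousLinearMap.adjoint_inner_right,
    inner_self_eq_norm_sq_to_K]
  have h : ((((‖(x : Ell2 G →L[ℂ] Ell2 G) (delta G)‖ : ℝ) : ℂ) ^ 2).re) =
      ‖(x : Ell2 G →L[ℂ] Ell2 G) (delta G)‖ ^ 2 := by
    rw [← Complex.ofReal_pow, Complex.ofReal_re]
  exact (congrArg Real.sqrt h).trans (Real.sqrt_sq (norm_nonneg _))

theorem twoNorm_nonneg {G : Type*} [Group G] (x : LG G) : 0 ≤ twoNorm x := Real.sqrt_nonneg _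

theorem twoNorm_add_le {G : Type*} [Group G] (x y : LG G) :
    twoNorm (x + y) ≤ twoNorm x + twoNorm y := by
  rw [twoNorm_eq, twoNorm_eq, twoNorm_eq]
  exact norm_add_le _ _

theorem twoNorm_unitary_mul {G : Type*} [Group G] (u : unitary (LG G)) (x : LG G) :
    twoNorm ((u : LG G) * x) = twoNorm x := by
  rw [twoNorm, twoNorm, star_mul, mul_assoc, ← mul_assoc (star (u : LG G)),
    Unitary.coe_star_mul_self, one_mul]

theorem twoNorm_neg {G : Type*} [Group G] (x : LG G) : twoNorm (-x) = twoNorm x := by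
  rw [twoNorm, twoNorm, star_neg, neg_mul_neg]

/-- The value at `z` of the family whose infimum is the projective length. -/
def distScalar {G : Type*} [Group G] (u : unitary (LG G)) (z : Circle) : ℝ :=
  twoNorm (algebraMap ℂ (LG G) z - (u : LG G))

theorem distScalar_mul_scalar {G : Type*} [Group G] (u : unitary (LG G)) (z w : Circle) :
    distScalar (u * scalarHom G w) (w * z) = distScalar u z := by
  rw [← scalarHom_commute, distScalar, distScalar,
    ← twoNorm_unitary_mul (scalarHom G w) (algebraMap ℂ (LG G) z - (u : LG G)), mul_sub]
  congr 2
  rw [Circle.coe_mul, map_mul]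
  rfl

theorem distScalar_inv {G : Type*} [Group G] (u : unitary (LG G)) (z : Circle) :
    distScalar u⁻¹ z⁻¹ = distScalar u z := by
  have h1 := twoNorm_unitary_mul (u * scalarHom G z) (algebraMap ℂ (LG G) (z⁻¹ : Circle) -
    ((u⁻¹ : unitary (LG G)) : LG G))
  have h2 : ((u * scalarHom G z : unitary (LG G)) : LG G) * (algebraMap ℂ (LG G) (z⁻¹ : Circle) -
      ((u⁻¹ : unitary (LG G)) : LG G)) = -(algebraMap ℂ (LG G) z - (u : LG G)) := by
    have e1 : u * scalarHom G z * scalarHom G z⁻¹ = u := by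
      rw [mul_assoc, ← map_mul, mul_inv_cancel, map_one, mul_one]
    have e2 : u * scalarHom G z * u⁻¹ = scalarHom G z := by
      rw [← scalarHom_commute, mul_inv_cancel_right]
    rw [mul_sub, neg_sub]
    exact congrArg₂ (· - ·) (congrArg Subtype.val e1) (congrArg Subtype.val e2)
  rw [distScalar, distScalar, ← h1, h2, twoNorm_neg]

theorem distScalar_mul_le {G : Type*} [Group G] (u v : unitary (LG G)) (z w : Circle) :
    distScalar (u * v) (z * w) ≤ distScalar u z + distScalar v w := by
  have h : algebraMap ℂ (LG G) ((z * w : Circle) : ℂ) - ((u * v : unitary (LG G)) : LG G) =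
      (scalarHom G w : LG G) * (algebraMap ℂ (LG G) z - (u : LG G)) +
        (u : LG G) * (algebraMap ℂ (LG G) w - (v : LG G)) := by
    have e : (scalarHom G w : LG G) * (u : LG G) = (u : LG G) * algebraMap ℂ (LG G) w :=
      congrArg Subtype.val (scalarHom_commute w u)
    have e' : (scalarHom G w : LG G) * algebraMap ℂ (LG G) z =
        algebraMap ℂ (LG G) ((z * w : Circle) : ℂ) := by
      rw [mul_comm z w, Circle.coe_mul, map_mul]
      rfl
    rw [mul_sub, mul_sub, e, e', sub_add_sub_cancel]
    rfl
  rw [distScalar, h]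
  refine (twoNorm_add_le _ _).trans ?_
  rw [twoNorm_unitary_mul, twoNorm_unitary_mul]
  rfl

theorem continuous_distScalar {G : Type*} [Group G] (u : unitary (LG G)) :
    Continuous (distScalar u) := by
  have h : distScalar u = fun z : Circle =>
      ‖(z : ℂ) • delta G - ((u : LG G) : Ell2 G →L[ℂ] Ell2 G) (delta G)‖ := by
    funext z
    rw [distScalar, twoNorm_eq]
    rfl
  rw [h]
  fun_prop

theorem bddBelow_distScalar {G : Type*} [Group G] (u : unitary (LG G)) :
    BddBelow (Set.range (distScalar u)) :=
  ⟨0, by rintro _ ⟨z, rfl⟩; exact twoNorm_nonneg _⟩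

theorem exists_preProjLength_eq {G : Type*} [Group G] (u : unitary (LG G)) :
    ∃ z : Circle, preProjLength u = distScalar u z := by
  obtain ⟨z, hz⟩ := (continuous_distScalar u).exists_forall_le_of_hasCompactSupport
    (HasCompactSupport.of_compactSpace _)
  exact ⟨z, le_antisymm (ciInf_le (bddBelow_distScalar u) z) (le_ciInf hz)⟩

theorem preProjLength_le {G : Type*} [Group G] (u : unitary (LG G)) (z : Circle) :
    preProjLength u ≤ distScalar u z := ciInf_le (bddBelow_distScalar u) z

theorem preProjLength_mul_scalar_le {G : Type*} [Group G] (u : unitary (LG G)) (w : Circle) :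
    preProjLength (u * scalarHom G w) ≤ preProjLength u := by
  obtain ⟨z, hz⟩ := exists_preProjLength_eq u
  rw [hz, ← distScalar_mul_scalar u z w]
  exact preProjLength_le _ _

theorem preProjLength_mul_scalar {G : Type*} [Group G] (u : unitary (LG G)) (w : Circle) :
    preProjLength (u * scalarHom G w) = preProjLength u := by
  refine le_antisymm (preProjLength_mul_scalar_le u w) ?_
  have h := preProjLength_mul_scalar_le (u * scalarHom G w) w⁻¹
  rwa [mul_assoc, ← map_mul, mul_inv_cancel, map_one, mul_one] at h

theorem preProjLength_inv_le {G : Type*} [Group G] (u : unitary (LG G)) :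
    preProjLength u⁻¹ ≤ preProjLength u := by
  obtain ⟨z, hz⟩ := exists_preProjLength_eq u
  rw [hz, ← distScalar_inv u z]
  exact preProjLength_le _ _

theorem preProjLength_mul_le {G : Type*} [Group G] (u v : unitary (LG G)) :
    preProjLength (u * v) ≤ preProjLength u + preProjLength v := by
  obtain ⟨z, hz⟩ := exists_preProjLength_eq u
  obtain ⟨w, hw⟩ := exists_preProjLength_eq v
  rw [hz, hw]
  exact (preProjLength_le _ _).trans (distScalar_mul_le u v z w)

/-- Right translation, which commutes with `LG`. -/
def rightTranslate {G : Type*} [Group G] (g : G) : Ell2 G →ₗᵢ[ℂ] Ell2 G where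
  toFun f := ⟨fun x => (f : ∀ _ : G, ℂ) (x * g),
    memℓp_gen ((Equiv.mulRight g).summable_iff.mpr ((lp.memℓp f).summable (by norm_num)))⟩
  map_add' f₁ f₂ := by ext x; rfl
  map_smul' c f := by ext x; simp
  norm_map' f := by
    rw [lp.norm_eq_tsum_rpow (by norm_num), lp.norm_eq_tsum_rpow (by norm_num)]
    congr 1
    exact (Equiv.mulRight g).tsum_eq (fun x => ‖(f : ∀ _ : G, ℂ) x‖ ^ ENNReal.toReal 2)

theorem rightTranslate_commute {G : Type*} [Group G] (g : G) (x : LG G) (f : Ell2 G) :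
    (x : Ell2 G →L[ℂ] Ell2 G) (rightTranslate g f) =
      rightTranslate g ((x : Ell2 G →L[ℂ] Ell2 G) f) := by
  have hR : (rightTranslate g).toContinuousLinearMap ∈
      StarSubalgebra.centralizer ℂ (Set.range (leftRegular G)) := by
    rw [StarSubalgebra.mem_centralizer_iff]
    have key : ∀ h : G, leftRegular G h * (rightTranslate g).toContinuousLinearMap =
        (rightTranslate g).toContinuousLinearMap * leftRegular G h := by
      intro h
      ext f y
      change (f : ∀ _ : G, ℂ) (h⁻¹ * y * g) = (f : ∀ _ : G, ℂ) (h⁻¹ * (y * g))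
      rw [mul_assoc]
    rintro _ ⟨h, rfl⟩
    rw [star_leftRegular]
    exact ⟨key h, key h⁻¹⟩
  have hx : (x : Ell2 G →L[ℂ] Ell2 G) ∈ StarSubalgebra.centralizer ℂ
    (StarSubalgebra.centralizer ℂ (Set.range (leftRegular G)) : Set (Ell2 G →L[ℂ] Ell2 G)) := x.2
  rw [StarSubalgebra.mem_centralizer_iff] at hx
  exact (congrArg (fun T : Ell2 G →L[ℂ] Ell2 G => T f) (hx _ hR).1).symm

/-- The vector `δ_1` is separating for `LG`. -/
theorem eq_zero_of_apply_delta {G : Type*} [Group G] (x : LG G)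
    (hx : (x : Ell2 G →L[ℂ] Ell2 G) (delta G) = 0) : x = 0 := by
  classical
  have h1 : ∀ g : G, (x : Ell2 G →L[ℂ] Ell2 G) (lp.single 2 g (1 : ℂ)) = 0 := by
    intro g
    have h2 : (lp.single 2 g (1 : ℂ) : Ell2 G) = rightTranslate g⁻¹ (delta G) := by
      ext y
      change (lp.single 2 g (1 : ℂ) : Ell2 G) y = (delta G : Ell2 G) (y * g⁻¹)
      unfold delta
      by_cases hy : y = g
      · subst hy; simp [lp.single_apply]
      · have : y * g⁻¹ ≠ 1 := fun h => hy (mul_inv_eq_one.mp h)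
        simp [lp.single_apply, hy, this]
    rw [h2, rightTranslate_commute, hx, map_zero]
  apply Subtype.ext
  refine ContinuousLinearMap.ext fun f => ?_
  have h3 := (lp.hasSum_single (p := 2) (by norm_num) f).mapL (x : Ell2 G →L[ℂ] Ell2 G)
  refine h3.unique ?_
  change HasSum _ (0 : Ell2 G)
  convert hasSum_zero (α := Ell2 G) (β := G) (L := .unconditional G) with g
  have h4 : (lp.single 2 g ((f : ∀ _ : G, ℂ) g) : Ell2 G) =
      (f : ∀ _ : G, ℂ) g • lp.single 2 g (1 : ℂ) := by
    rw [← lp.single_smul, smul_eq_mul, mul_one]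
  rw [h4, map_smul, h1, smul_zero]

theorem mem_scalars_of_preProjLength {G : Type*} [Group G] (u : unitary (LG G))
    (hu : preProjLength u = 0) : u ∈ scalars G := by
  obtain ⟨z, hz⟩ := exists_preProjLength_eq u
  rw [hu, distScalar, twoNorm_eq, eq_comm, norm_eq_zero] at hz
  exact ⟨z, Subtype.ext (sub_eq_zero.mp (eq_zero_of_apply_delta _ hz))⟩

theorem preProjLength_one {G : Type*} [Group G] :
    preProjLength (1 : unitary (LG G)) = 0 := by
  refine le_antisymm ((preProjLength_le _ 1).trans (le_of_eq ?_))
    (le_ciInf fun z => twoNorm_nonneg _)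
  rw [distScalar, twoNorm_eq]
  simp

/-- The projective length function `ℓ̄` on `PU(LG)`: the infimum of `‖z - u‖₂` over `|z| = 1`, for
any lift `u ∈ U(LG)`. -/
def projLength {G : Type*} [Group G] : PU G → ℝ :=
  Quotient.lift (preProjLength (G := G)) (by
    intro u v huv
    obtain ⟨z, hz⟩ := QuotientGroup.leftRel_apply.mp huv
    rw [← preProjLength_mul_scalar u z, hz, mul_inv_cancel_left])

theorem projLength_toPU {G : Type*} [Group G] (u : unitary (LG G)) :
    projLength (toPU G u) = preProjLength u := rfl

theorem toPU_surjective {G : Type*} [Group G] : Function.Surjective (toPU G) :=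
  QuotientGroup.mk'_surjective _

theorem projLength_inv_le {G : Type*} [Group G] (x : PU G) : projLength x⁻¹ ≤ projLength x := by
  obtain ⟨u, rfl⟩ := toPU_surjective x
  exact preProjLength_inv_le u

theorem projLength_mul_le {G : Type*} [Group G] (x y : PU G) :
    projLength (x * y) ≤ projLength x + projLength y := by
  obtain ⟨u, rfl⟩ := toPU_surjective x
  obtain ⟨v, rfl⟩ := toPU_surjective y
  exact preProjLength_mul_le u v

/-- The metric on `PU(LG)` given by the projective length, `d(x, y) = ℓ̄(x⁻¹ y)`; for lifts `u`, `v`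
it is the infimum of `‖z u - v‖₂` over `|z| = 1`. -/
instance (G : Type*) [Group G] : MetricSpace (PU G) where
  dist x y := projLength (x⁻¹ * y)
  dist_self x := by
    rw [inv_mul_cancel]
    exact preProjLength_one
  dist_comm x y := by
    apply le_antisymm
    · have h := projLength_inv_le (y⁻¹ * x)
      rwa [mul_inv_rev, inv_inv] at h
    · have h := projLength_inv_le (x⁻¹ * y)
      rwa [mul_inv_rev, inv_inv] at h
  dist_triangle x y z := by
    have h := projLength_mul_le (x⁻¹ * y) (y⁻¹ * z)
    rwa [mul_assoc, mul_inv_cancel_left] at h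
  eq_of_dist_eq_zero := by
    intro x y h
    obtain ⟨u, rfl⟩ := toPU_surjective x
    obtain ⟨v, rfl⟩ := toPU_surjective y
    exact QuotientGroup.eq.mpr (mem_scalars_of_preProjLength (u⁻¹ * v) h)

/-- A family of subgroups of `PU(LG)` is uniformly discrete if some ball around the identity
contains no non-trivial element of any member of the family. -/
def UniformlyDiscrete {G : Type*} [Group G] (S : Set (Subgroup (PU G))) : Prop :=
  ∃ ε : ℝ, 0 < ε ∧ ∀ Γ ∈ S, ∀ x ∈ Γ, projLength x < ε → x = 1

/-- The value `w(u, g)` in `U(LG)` of a word `w` of the free group on two letters at a unitary `u`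
and a group element `g`. -/
def wordEval {G : Type*} [Group G] (u : unitary (LG G)) (g : G) :
    FreeGroup (Fin 2) →* unitary (LG G) :=
  FreeGroup.lift ![u, groupUnitary G g]

end GroupVN

end

/-!
Let `u ∈ U(LG)` and let `g ∈ G` be generic. Since `G` is mixed identity free, finitely many
non-trivial words of `G ∗ ℤ` can be avoided simultaneously by a substitution `t ↦ g`
(`exists_common_word`), so there is a proper filter on `G` along which every non-trivial word is
eventually non-trivial (`genericFilter`). As `τ(λ_h) = 0` for `h ≠ 1`, the element `g` is
asymptotically free from `LG` along this filter (`freeFrom_constants`): the trace of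
`b₁ g^{k₁} b₂ g^{k₂} ⋯ bₘ g^{kₘ}` tends to `0` when the `bᵢ` have trace zero and `kᵢ ≠ 0` for
`i < m`. This passes from group elements to all of `LG` by replacing one letter at a time.

In particular `u` and `v = g u g⁻¹` are asymptotically free, and then the trace of the commutator
`[u, v]` tends to `2c - c²` with `c = |τ(u)|²` (`FreeFrom.commutator_sub_mem`). So
`1 - |τ([u, v])|` is close to `(1 - |τ(u)|²)² ≤ 4 (1 - |τ(u)|)²`: positive when `u` is not a
scalar, and smaller than `1 - |τ(u)|` when `|τ(u)| > 3/4`. The commutator lies in the algebra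
generated by `LG` and `g LG g⁻¹`, which is free from `g²` (`FreeFrom.sq`), so the step can be
repeated with powers of the same `g`. The iterated commutators are not scalars, and their traces
tend to `1` (`traceSeq_bounds`), hence their lengths tend to `0`. An element of `PU(LG)` of
projective length in `(0, 1/√2)` has a lift with `Re τ > 3/4`, so the statements on discreteness
follow.

To avoid limit algebras, freeness is formulated in the algebra of all families `G → LG`, relative to
the subspace `nullTrace F` of families whose traces tend to `0` along the filter `F`.
-/

noncomputable section

namespace GroupVN

open Filter Topology Monoid

universe v

/-! ### Substitutions avoiding finitely many mixed identities -/

/-- The two factors of `G ∗ ℤ`: the letters of kind `false` come from `G`, those of kind `true`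
are powers of the generator `t`. -/
def Letter (G : Type v) : Bool → Type v
  | true => ULift (Multiplicative ℤ)
  | false => G

instance (G : Type v) [Group G] : ∀ b, Group (Letter G b)
  | true => inferInstanceAs (Group (ULift (Multiplicative ℤ)))
  | false => inferInstanceAs (Group G)

/-- The free product `G ∗ ℤ` in the indexed model, whose elements have reduced words. -/
abbrev MixedWord (G : Type v) [Group G] : Type v := CoprodI (Letter G)

/-- A coefficient `h ∈ G`, as a mixed word. -/
def coeff {G : Type v} [Group G] : G →* MixedWord G := CoprodI.of (M := Letter G) (i := false)

/-- The powers of the generator, as mixed words. -/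
def powHom {G : Type v} [Group G] : Multiplicative ℤ →* MixedWord G :=
  (CoprodI.of (M := Letter G) (i := true)).comp
    (MulEquiv.ulift (α := Multiplicative ℤ)).symm.toMonoidHom

/-- The mixed word `t ^ k`. -/
def genPow {G : Type v} [Group G] (k : ℤ) : MixedWord G := powHom (Multiplicative.ofAdd k)

/-- The substitution `t ↦ g`. -/
def wordAt {G : Type v} [Group G] (g : G) : MixedWord G →* G :=
  CoprodI.lift fun b => match b with
    | true => (zpowersHom G g).comp (MulEquiv.ulift (α := Multiplicative ℤ)).toMonoidHom
    | false => MonoidHom.id G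

theorem wordAt_coeff {G : Type v} [Group G] (g h : G) : wordAt g (coeff h) = h :=
  rfl

theorem wordAt_genPow {G : Type v} [Group G] (g : G) (k : ℤ) : wordAt g (genPow k) = g ^ k :=
  rfl

theorem neWord_prod_ne_one {ι : Type*} {M : ι → Type*} [∀ i, Monoid (M i)]
    {i j : ι} (w : CoprodI.NeWord M i j) : w.prod ≠ 1 := by
  classical
  intro h
  have h1 : w.toWord = CoprodI.Word.empty :=
    CoprodI.Word.equiv.symm.injective (h.trans CoprodI.Word.prod_empty.symm)
  exact w.toList_ne_nil (congrArg CoprodI.Word.toList h1)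

theorem exists_neWord {ι : Type*} {M : ι → Type*} [∀ i, Monoid (M i)] (x : CoprodI M)
    (hx : x ≠ 1) : ∃ (i j : ι) (w : CoprodI.NeWord M i j), w.prod = x := by
  classical
  obtain ⟨i, j, w, hw⟩ := CoprodI.NeWord.of_word (CoprodI.Word.equiv x) (by
    intro h
    apply hx
    rw [← CoprodI.Word.equiv.symm_apply_apply x, h]
    exact CoprodI.Word.prod_empty)
  refine ⟨i, j, w, ?_⟩
  rw [CoprodI.NeWord.prod, hw]
  exact CoprodI.Word.equiv.symm_apply_apply x

/-- The one-letter word `h ∈ G`. -/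
def coeffWord {G : Type v} [Group G] (h : G) (hh : h ≠ 1) :
    CoprodI.NeWord (Letter G) false false := .singleton h hh

theorem coeffWord_prod {G : Type v} [Group G] (h : G) (hh : h ≠ 1) :
    (coeffWord h hh).prod = coeff h := by
  exact CoprodI.NeWord.prod_singleton (M := Letter G) (i := false) h hh

/-- The one-letter word `t ^ k`. -/
def powWord (G : Type v) [Group G] (k : ℤ) (hk : k ≠ 0) :
    CoprodI.NeWord (Letter G) true true :=
  .singleton (M := Letter G) (i := true) (ULift.up (Multiplicative.ofAdd k)) (by
    intro h
    exact hk (congrArg (fun x : ULift (Multiplicative ℤ) => Multiplicative.toAdd x.down) h))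

theorem powWord_prod {G : Type v} [Group G] (k : ℤ) (hk : k ≠ 0) :
    (powWord G k hk).prod = genPow k := CoprodI.NeWord.prod_singleton _ _

/-- A word that starts in `ℤ` and ends in `G` is conjugate to one that starts and ends in `ℤ`:
conjugate by a power of `t` that does not cancel the first letter. -/
theorem exists_conj_of_true_false {G : Type v} [Group G]
    (w : CoprodI.NeWord (Letter G) true false) :
    ∃ (s : MixedWord G) (w' : CoprodI.NeWord (Letter G) true true),
      w'.prod = s * w.prod * s⁻¹ := by
  have : ∃ x : Letter G true, x ≠ 1 ∧ x * w.head ≠ 1 := by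
    have h : ∀ y : Multiplicative ℤ, ∃ x : Multiplicative ℤ, x ≠ 1 ∧ x * y ≠ 1 := by
      intro y
      by_cases hy : y = Multiplicative.ofAdd (-1)
      · subst hy
        exact ⟨Multiplicative.ofAdd 2, by decide, by decide⟩
      · refine ⟨Multiplicative.ofAdd 1, by decide, fun h => hy ?_⟩
        rw [eq_inv_of_mul_eq_one_right h]
        rfl
    obtain ⟨x, hx, hxy⟩ := h (ULift.down (show ULift (Multiplicative ℤ) from w.head))
    exact ⟨ULift.up x, fun h => hx (congrArg ULift.down h), fun h => hxy (congrArg ULift.down h)⟩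
  obtain ⟨x, hx, hxw⟩ := this
  refine ⟨CoprodI.of x, (w.mulHead x hxw).append (by decide) (.singleton x⁻¹ (inv_ne_one.mpr hx)),
    ?_⟩
  simp

theorem exists_conj_true_true {G : Type v} [Group G] (x : MixedWord G) (hx : x ≠ 1) :
    ∃ (s : MixedWord G) (w : CoprodI.NeWord (Letter G) true true), w.prod = s * x * s⁻¹ := by
  obtain ⟨i, j, w, rfl⟩ := exists_neWord x hx
  match i, j, w with
  | true, true, w => exact ⟨1, w, by simp⟩
  | false, false, w =>
    refine ⟨genPow 1, ((powWord G 1 one_ne_zero).append (by decide) w).append (by decide)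
      (powWord G 1 one_ne_zero).inv, ?_⟩
    simp [powWord_prod]
  | true, false, w => exact exists_conj_of_true_false w
  | false, true, w =>
    obtain ⟨s, w', h⟩ := exists_conj_of_true_false w.inv
    exact ⟨s, w'.inv, by simp [h, mul_assoc]⟩

/-- Two non-trivial mixed words vanish only where a single non-trivial mixed word does: after
conjugating, one starts and ends in `G` and the other in `ℤ`, and then their commutator is
reduced. -/
theorem exists_common_word {G : Type v} [Group G] [Nontrivial G] (x y : MixedWord G) (hx : x ≠ 1)
    (hy : y ≠ 1) : ∃ z : MixedWord G, z ≠ 1 ∧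
      ∀ g : G, wordAt g z ≠ 1 → wordAt g x ≠ 1 ∧ wordAt g y ≠ 1 := by
  obtain ⟨h, hh⟩ := exists_ne (1 : G)
  obtain ⟨s, w, hw⟩ := exists_conj_true_true x hx
  obtain ⟨r, w', hw'⟩ := exists_conj_true_true y hy
  have hW := neWord_prod_ne_one ((((coeffWord h hh).append (by decide) w).append (by decide)
    (coeffWord h hh).inv).append (i := false) (by decide) (w'.append (by decide)
    ((((coeffWord h hh).append (by decide) w.inv).append (by decide)
    (coeffWord h hh).inv).append (by decide) w'.inv)))
  refine ⟨_, hW, fun g hg => ?_⟩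
  simp only [CoprodI.NeWord.append_prod, CoprodI.NeWord.inv_prod, hw, hw', map_mul, map_inv]
    at hg
  constructor
  · intro h1
    apply hg
    rw [h1]
    group
  · intro h1
    apply hg
    rw [h1]
    group

/-- The homomorphism from the indexed model of the free product to the binary one. -/
def toCoprod {G : Type v} [Group G] : MixedWord G →* Coprod (Multiplicative ℤ) G :=
  CoprodI.lift fun b => match b with
    | true => Coprod.inl.comp (MulEquiv.ulift (α := Multiplicative ℤ)).toMonoidHom
    | false => Coprod.inr

theorem toCoprod_injective {G : Type v} [Group G] :
    Function.Injective (toCoprod (G := G)) := by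
  have h : (Coprod.lift powHom coeff).comp (toCoprod (G := G)) = MonoidHom.id _ := by
    apply CoprodI.ext_hom
    rintro (_ | _)
    · ext x
      exact Coprod.lift_apply_inr powHom coeff x
    · ext x
      exact Coprod.lift_apply_inl powHom coeff (ULift.down x)
  exact Function.LeftInverse.injective fun x => DFunLike.congr_fun h x

theorem mixedEval_toCoprod {G : Type v} [Group G] (g : G) (x : MixedWord G) :
    mixedEval g (toCoprod x) = wordAt g x := by
  have h : (mixedEval g).comp toCoprod = wordAt g := by
    apply CoprodI.ext_hom
    rintro (_ | _)
    · ext x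
      exact Coprod.lift_apply_inr (zpowersHom G g) (MonoidHom.id G) x
    · ext x
      exact Coprod.lift_apply_inl (zpowersHom G g) (MonoidHom.id G) (ULift.down x)
  exact DFunLike.congr_fun h x

theorem IsMIF.exists_wordAt_ne_one {G : Type v} [Group G] (hG : IsMIF G) (x : MixedWord G)
    (hx : x ≠ 1) : ∃ g : G, wordAt g x ≠ 1 := by
  by_contra! h
  apply hx
  apply toCoprod_injective
  rw [map_one]
  exact hG _ fun g => by rw [mixedEval_toCoprod, h]

theorem IsMIF.nontrivial {G : Type v} [Group G] (hG : IsMIF G) : Nontrivial G := by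
  obtain ⟨g, hg⟩ := hG.exists_wordAt_ne_one (genPow 1)
    (by rw [← powWord_prod 1 one_ne_zero]; exact neWord_prod_ne_one _)
  exact ⟨⟨_, _, hg⟩⟩

/-- The filter of generic substitutions: it contains the set where `x` does not vanish, for each
non-trivial mixed word `x`. -/
def genericFilter (G : Type v) [Group G] : Filter G :=
  ⨅ x : {x : MixedWord G // x ≠ 1}, 𝓟 {g | wordAt g (x : MixedWord G) ≠ 1}

theorem eventually_wordAt_ne_one {G : Type v} [Group G] (x : MixedWord G) (hx : x ≠ 1) :
    ∀ᶠ g in genericFilter G, wordAt g x ≠ 1 :=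
  mem_iInf_of_mem (⟨x, hx⟩ : {x : MixedWord G // x ≠ 1}) (mem_principal_self _)

theorem IsMIF.neBot_genericFilter {G : Type v} [Group G] (hG : IsMIF G) :
    (genericFilter G).NeBot := by
  have := hG.nontrivial
  have : Nonempty {x : MixedWord G // x ≠ 1} :=
    ⟨⟨genPow 1, by rw [← powWord_prod 1 one_ne_zero]; exact neWord_prod_ne_one _⟩⟩
  refine iInf_neBot_of_directed' ?_ fun x => ?_
  · rintro ⟨x, hx⟩ ⟨y, hy⟩
    obtain ⟨z, hz, h⟩ := exists_common_word x y hx hy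
    exact ⟨⟨z, hz⟩, principal_mono.mpr fun g hg => (h g hg).1,
      principal_mono.mpr fun g hg => (h g hg).2⟩
  · exact principal_neBot_iff.mpr (hG.exists_wordAt_ne_one x x.2)

/-! ### Freeness modulo a trace-like subspace -/

theorem zpow_mul_zpow_mul {A : Type*} [Ring A] (t : Aˣ) (i j : ℤ) (a : A) :
    (↑(t ^ i) * (↑(t ^ j) * a) : A) = ↑(t ^ (i + j)) * a := by
  rw [zpow_add, Units.val_mul, mul_assoc]

section Freeness

variable {A : Type*} [Ring A] [Algebra ℂ A]

/-- The products `b₁ t^{k₁} b₂ t^{k₂} ⋯ bₘ t^{kₘ}` with `m ≥ 1`, all `bᵢ ∈ B` centred (that is, in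
`Z`) and `kᵢ ≠ 0` for `i < m`; the last exponent is arbitrary. -/
inductive Reduced (Z : Submodule ℂ A) (B : Subalgebra ℂ A) (t : Aˣ) : A → Prop
  | single (b : A) (hb : b ∈ B) (hZ : b ∈ Z) (k : ℤ) : Reduced Z B t (b * ↑(t ^ k))
  | cons (b : A) (hb : b ∈ B) (hZ : b ∈ Z) (k : ℤ) (hk : k ≠ 0) (r : A) (hr : Reduced Z B t r) :
      Reduced Z B t (b * (↑(t ^ k) * r))

/-- `B` is free from `t` with respect to `Z`, where `Z` plays the role of the kernel of a trace:
every element of `B` is a scalar modulo `Z`, and reduced products lie in `Z`. -/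
structure FreeFrom (Z : Submodule ℂ A) (B : Subalgebra ℂ A) (t : Aˣ) : Prop where
  exists_scalar : ∀ b ∈ B, ∃ c : ℂ, b - algebraMap ℂ A c ∈ Z
  reduced_mem : ∀ r, Reduced Z B t r → r ∈ Z

/-- The alternating products of centred elements of `B` and of `t B t⁻¹`; the index says whether
the first factor comes from `t B t⁻¹`. -/
inductive Alternating (Z : Submodule ℂ A) (B : Subalgebra ℂ A) (t : Aˣ) : Bool → A → Prop
  | single (s : Bool) (b : A) (hb : b ∈ B) (hZ : b ∈ Z) :
      Alternating Z B t s (↑(t ^ (s.toNat : ℤ)) * b * ↑(t ^ (-(s.toNat : ℤ))))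
  | cons (s : Bool) (b : A) (hb : b ∈ B) (hZ : b ∈ Z) (p : A) (hp : Alternating Z B t (!s) p) :
      Alternating Z B t s (↑(t ^ (s.toNat : ℤ)) * b * ↑(t ^ (-(s.toNat : ℤ))) * p)

/-- The algebra generated by `B` and `t B t⁻¹`. -/
def adjoinConj (B : Subalgebra ℂ A) (t : Aˣ) : Subalgebra ℂ A :=
  Algebra.adjoin ℂ ((B : Set A) ∪ (fun b => ↑t * b * ↑t⁻¹) '' B)

variable {Z : Submodule ℂ A} {B : Subalgebra ℂ A} {t : Aˣ}

theorem Reduced.mul_zpow {r : A} (hr : Reduced Z B t r) (j : ℤ) :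
    Reduced Z B t (r * ↑(t ^ j)) := by
  induction hr with
  | single b hb hZ k =>
    rw [mul_assoc, ← Units.val_mul, ← zpow_add]
    exact .single b hb hZ _
  | cons b hb hZ k hk r _ ih =>
    rw [mul_assoc, mul_assoc]
    exact .cons b hb hZ k hk _ ih

theorem Alternating.exists_eq_zpow_mul_zpow {s : Bool} {p : A} (hp : Alternating Z B t s p)
    (j : ℤ) : ∃ r, Reduced Z B t r ∧ p * ↑(t ^ j) = ↑(t ^ (s.toNat : ℤ)) * r := by
  induction hp with
  | single s b hb hZ =>
    refine ⟨_, .single b hb hZ (-(s.toNat : ℤ) + j), ?_⟩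
    rw [zpow_add, Units.val_mul]
    simp only [mul_assoc]
  | cons s b hb hZ p hp ih =>
    obtain ⟨r, hr, h⟩ := ih
    refine ⟨_, .cons b hb hZ (-(s.toNat : ℤ) + ((!s).toNat : ℤ)) (by cases s <;> simp) r hr, ?_⟩
    rw [mul_assoc, h, mul_assoc, mul_assoc, zpow_mul_zpow_mul]

/-- The exponent `j` does not cancel against the last factor of `p`, which ends in `1` or `t⁻¹`. -/
theorem Alternating.exists_eq_zpow_mul_mul {s : Bool} {p : A} (hp : Alternating Z B t s p)
    (j : ℤ) (h0 : j ≠ 0) (h1 : j ≠ 1) (r : A) (hr : Reduced Z B t r) :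
    ∃ r', Reduced Z B t r' ∧ p * (↑(t ^ j) * r) = ↑(t ^ (s.toNat : ℤ)) * r' := by
  induction hp with
  | single s b hb hZ =>
    refine ⟨_, .cons b hb hZ (-(s.toNat : ℤ) + j) (by cases s <;> simp <;> omega) r hr, ?_⟩
    rw [mul_assoc, zpow_mul_zpow_mul, mul_assoc]
  | cons s b hb hZ p hp ih =>
    obtain ⟨r', hr', h⟩ := ih
    refine ⟨_, .cons b hb hZ (-(s.toNat : ℤ) + ((!s).toNat : ℤ)) (by cases s <;> simp) r' hr', ?_⟩
    rw [mul_assoc, h, mul_assoc, mul_assoc, zpow_mul_zpow_mul]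

theorem Alternating.mem (hF : FreeFrom Z B t) (hZ : ∀ a b : A, a * b ∈ Z → b * a ∈ Z)
    {s : Bool} {p : A} (hp : Alternating Z B t s p) : p ∈ Z := by
  obtain ⟨r, hr, h⟩ := hp.exists_eq_zpow_mul_zpow 0
  rw [zpow_zero, Units.val_one, mul_one] at h
  rw [h]
  exact hZ _ _ (hF.reduced_mem _ (hr.mul_zpow _))

/-- The alternating products of either kind. -/
def alternatingSet (Z : Submodule ℂ A) (B : Subalgebra ℂ A) (t : Aˣ) : Set A :=
  {p | ∃ s, Alternating Z B t s p}

theorem mul_mem_span_alternating (hF : FreeFrom Z B t) (s : Bool) (b : A) (hb : b ∈ B) (p : A)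
    (hp : p ∈ Submodule.span ℂ (insert 1 (alternatingSet Z B t))) :
    ↑(t ^ (s.toNat : ℤ)) * b * ↑(t ^ (-(s.toNat : ℤ))) * p ∈
      Submodule.span ℂ (insert 1 (alternatingSet Z B t)) := by
  set W := Submodule.span ℂ (insert (1 : A) (alternatingSet Z B t)) with hW
  have halt : ∀ s p, Alternating Z B t s p → p ∈ W := fun s p h =>
    Submodule.subset_span (Set.mem_insert_of_mem _ ⟨s, h⟩)
  have hone : (1 : A) ∈ W := Submodule.subset_span (Set.mem_insert _ _)
  -- Splitting off the scalar part of the middle factor reduces to a centred one.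
  have split : ∀ b ∈ B, ∀ p ∈ W,
      (∀ b ∈ B, b ∈ Z → ↑(t ^ (s.toNat : ℤ)) * b * ↑(t ^ (-(s.toNat : ℤ))) * p ∈ W) →
      ↑(t ^ (s.toNat : ℤ)) * b * ↑(t ^ (-(s.toNat : ℤ))) * p ∈ W := by
    intro b hb p hp h
    obtain ⟨c, hc⟩ := hF.exists_scalar b hb
    have e : (↑(t ^ (s.toNat : ℤ)) * b * ↑(t ^ (-(s.toNat : ℤ))) * p : A) =
        ↑(t ^ (s.toNat : ℤ)) * (b - algebraMap ℂ A c) * ↑(t ^ (-(s.toNat : ℤ))) * p + c • p := by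
      rw [mul_sub, sub_mul, sub_mul, ← Algebra.commutes c, mul_assoc (algebraMap ℂ A c),
        ← Units.val_mul, ← zpow_add, add_neg_cancel, zpow_zero, Units.val_one, mul_one,
        ← Algebra.smul_def, sub_add_cancel]
    rw [e]
    exact add_mem (h _ (sub_mem hb (B.algebraMap_mem c)) hc) (W.smul_mem c hp)
  induction hp using Submodule.span_induction with
  | zero => simp
  | add x y _ _ hx hy => rw [mul_add]; exact add_mem hx hy
  | smul c x _ hx => rw [mul_smul_comm]; exact W.smul_mem c hx
  | mem p hp =>
    obtain rfl | ⟨s', hp⟩ := hp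
    · refine split b hb 1 hone fun b hb hZ => ?_
      rw [mul_one]
      exact halt _ _ (.single s b hb hZ)
    by_cases hs : s' = !s
    · subst hs
      exact split b hb p (halt _ _ hp) fun b hb hZ => halt _ _ (.cons s b hb hZ p hp)
    obtain rfl : s' = s := by cases s <;> cases s' <;> simp_all
    cases hp with
    | single _ b' hb' hZ' =>
      have e := split (b * b') (mul_mem hb hb') 1 hone fun b hb hZ => by
        rw [mul_one]
        exact halt _ _ (.single s' b hb hZ)
      rw [mul_one] at e
      convert e using 1
      simp only [mul_assoc, zpow_mul_zpow_mul]
      simp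
    | cons _ b' hb' hZ' p hp =>
      have e := split (b * b') (mul_mem hb hb') p (halt _ _ hp) fun b hb hZ =>
        halt _ _ (.cons s' b hb hZ p hp)
      convert e using 1
      simp only [mul_assoc, zpow_mul_zpow_mul]
      simp

theorem adjoinConj_le_span (hF : FreeFrom Z B t) {p : A} (hp : p ∈ adjoinConj B t) :
    p ∈ Submodule.span ℂ (insert 1 (alternatingSet Z B t)) := by
  suffices h : ∀ q ∈ Submodule.span ℂ (insert (1 : A) (alternatingSet Z B t)),
      p * q ∈ Submodule.span ℂ (insert (1 : A) (alternatingSet Z B t)) by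
    simpa using h 1 (Submodule.subset_span (Set.mem_insert _ _))
  induction hp using Algebra.adjoin_induction with
  | mem x hx =>
    intro q hq
    obtain hx | ⟨b, hb, rfl⟩ := hx
    · simpa using mul_mem_span_alternating hF false x hx q hq
    · simpa using mul_mem_span_alternating hF true b hb q hq
  | algebraMap c =>
    intro q hq
    rw [← Algebra.smul_def]
    exact Submodule.smul_mem _ c hq
  | add x y _ _ hx hy =>
    intro q hq
    rw [add_mul]
    exact add_mem (hx q hq) (hy q hq)
  | mul x y _ _ hx hy =>
    intro q hq
    rw [mul_assoc]
    exact hx _ (hy q hq)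

theorem exists_sub_mem_span_alternating (hF : FreeFrom Z B t) {p : A} (hp : p ∈ adjoinConj B t) :
    ∃ c : ℂ, p - algebraMap ℂ A c ∈ Submodule.span ℂ (alternatingSet Z B t) := by
  obtain ⟨c, q, hq, rfl⟩ := Submodule.mem_span_insert.mp (adjoinConj_le_span hF hp)
  refine ⟨c, ?_⟩
  rwa [Algebra.algebraMap_eq_smul_one, add_sub_cancel_left]

theorem span_alternating_le (hF : FreeFrom Z B t) (hZ : ∀ a b : A, a * b ∈ Z → b * a ∈ Z) :
    Submodule.span ℂ (alternatingSet Z B t) ≤ Z :=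
  Submodule.span_le.mpr fun _ ⟨_, h⟩ => h.mem hF hZ

theorem mem_span_alternating (hF : FreeFrom Z B t) (hZ : ∀ a b : A, a * b ∈ Z → b * a ∈ Z)
    (h1 : (1 : A) ∉ Z) {p : A} (hp : p ∈ adjoinConj B t) (hpZ : p ∈ Z) :
    p ∈ Submodule.span ℂ (alternatingSet Z B t) := by
  obtain ⟨c, hc⟩ := exists_sub_mem_span_alternating hF hp
  have h2 : algebraMap ℂ A c ∈ Z := by
    simpa using sub_mem hpZ (span_alternating_le hF hZ hc)
  have h3 : c = 0 := by
    by_contra h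
    rw [Algebra.algebraMap_eq_smul_one] at h2
    exact h1 ((Z.smul_mem_iff h).mp h2)
  rwa [h3, map_zero, sub_zero] at hc

/-- Every reduced product over `B ∨ t B t⁻¹` and `t ^ 2` is a combination of reduced products over
`B` and `t`, up to a factor `t` on the left. -/
theorem Reduced.mem_span_of_sq (hF : FreeFrom Z B t) (hZ : ∀ a b : A, a * b ∈ Z → b * a ∈ Z)
    (h1 : (1 : A) ∉ Z) {r : A} (hr : Reduced Z (adjoinConj B t) (t ^ 2) r) :
    r ∈ Submodule.span ℂ
      {x : A | ∃ (s : Bool) (y : A), Reduced Z B t y ∧ x = ↑(t ^ (s.toNat : ℤ)) * y} := by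
  have hpow : ∀ k : ℤ, (t ^ 2) ^ k = t ^ (2 * k) := fun k => by
    rw [zpow_mul]; norm_cast
  induction hr with
  | single b hb hbZ k =>
    have hb' := mem_span_alternating hF hZ h1 hb hbZ
    rw [hpow]
    clear hb hbZ
    induction hb' using Submodule.span_induction with
    | zero => simp
    | add x y _ _ hx hy => rw [add_mul]; exact add_mem hx hy
    | smul c x _ hx => rw [smul_mul_assoc]; exact Submodule.smul_mem _ c hx
    | mem p hp =>
      obtain ⟨s, hp⟩ := hp
      obtain ⟨y, hy, h⟩ := hp.exists_eq_zpow_mul_zpow (2 * k)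
      exact Submodule.subset_span ⟨s, y, hy, h⟩
  | cons b hb hbZ k hk r hr ih =>
    have hb' := mem_span_alternating hF hZ h1 hb hbZ
    rw [hpow]
    clear hb hbZ
    induction hb' using Submodule.span_induction with
    | zero => simp
    | add x y _ _ hx hy => rw [add_mul]; exact add_mem hx hy
    | smul c x _ hx => rw [smul_mul_assoc]; exact Submodule.smul_mem _ c hx
    | mem p hp =>
      obtain ⟨s, hp⟩ := hp
      clear hr
      induction ih using Submodule.span_induction with
      | zero => simp
      | add x y _ _ hx hy => rw [mul_add, mul_add]; exact add_mem hx hy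
      | smul c x _ hx => rw [mul_smul_comm, mul_smul_comm]; exact Submodule.smul_mem _ c hx
      | mem q hq =>
        obtain ⟨s', y, hy, rfl⟩ := hq
        obtain ⟨y', hy', h⟩ := hp.exists_eq_zpow_mul_mul (2 * k + (s'.toNat : ℤ))
          (by cases s' <;> simp <;> omega) (by cases s' <;> simp <;> omega) y hy
        rw [zpow_mul_zpow_mul, h]
        exact Submodule.subset_span ⟨s, y', hy', rfl⟩

/-- If `B` is free from `t`, then `B ∨ t B t⁻¹` is free from `t ^ 2`. -/
theorem FreeFrom.sq (hF : FreeFrom Z B t) (hZ : ∀ a b : A, a * b ∈ Z → b * a ∈ Z)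
    (h1 : (1 : A) ∉ Z) : FreeFrom Z (adjoinConj B t) (t ^ 2) where
  exists_scalar p hp := by
    obtain ⟨c, hc⟩ := exists_sub_mem_span_alternating hF hp
    exact ⟨c, span_alternating_le hF hZ hc⟩
  reduced_mem r hr := by
    refine Submodule.span_le.mpr ?_ (hr.mem_span_of_sq hF hZ h1)
    rintro _ ⟨s, y, hy, rfl⟩
    exact hZ _ _ (hF.reduced_mem _ (hy.mul_zpow _))

/-- If `B` is free from `t` and the unit `u` of `B` has trace `a` and inverse of trace `a'`, then
the commutator of `u` and `t u t⁻¹` has trace `2 a a' - (a a')²`. -/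
theorem FreeFrom.commutator_sub_mem (hF : FreeFrom Z B t)
    (hZ : ∀ a b : A, a * b ∈ Z → b * a ∈ Z) (u : Aˣ) (hu : (u : A) ∈ B) (hu' : (↑u⁻¹ : A) ∈ B)
    (a a' : ℂ) (ha : (u : A) - algebraMap ℂ A a ∈ Z) (ha' : (↑u⁻¹ : A) - algebraMap ℂ A a' ∈ Z) :
    (↑(u * (t * u * t⁻¹) * u⁻¹ * (t * u * t⁻¹)⁻¹) : A) -
      algebraMap ℂ A (2 * (a * a') - (a * a') ^ 2) ∈ Z := by
  have red2 : ∀ b₁ ∈ B, b₁ ∈ Z → ∀ b₂ ∈ B, b₂ ∈ Z → b₁ * (↑t * b₂ * ↑t⁻¹) ∈ Z := by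
    intro b₁ h₁ z₁ b₂ h₂ z₂
    refine hF.reduced_mem _ ?_
    have h := Reduced.cons b₁ h₁ z₁ 1 one_ne_zero _ (.single (t := t) b₂ h₂ z₂ (-1))
    simpa [mul_assoc] using h
  have red4 : ∀ b₁ ∈ B, b₁ ∈ Z → ∀ b₂ ∈ B, b₂ ∈ Z → ∀ b₃ ∈ B, b₃ ∈ Z → ∀ b₄ ∈ B, b₄ ∈ Z →
      b₁ * (↑t * b₂ * ↑t⁻¹) * b₃ * (↑t * b₄ * ↑t⁻¹) ∈ Z := by
    intro b₁ h₁ z₁ b₂ h₂ z₂ b₃ h₃ z₃ b₄ h₄ z₄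
    refine hF.reduced_mem _ ?_
    have h := Reduced.cons b₁ h₁ z₁ 1 one_ne_zero _ (.cons b₂ h₂ z₂ (-1) (by norm_num) _
      (.cons b₃ h₃ z₃ 1 one_ne_zero _ (.single (t := t) b₄ h₄ z₄ (-1))))
    simpa [mul_assoc] using h
  set x : A := (u : A) - algebraMap ℂ A a with hx
  set x' : A := (↑u⁻¹ : A) - algebraMap ℂ A a' with hx'
  have hxB : x ∈ B := sub_mem hu (B.algebraMap_mem a)
  have hxB' : x' ∈ B := sub_mem hu' (B.algebraMap_mem a')
  have eu : (u : A) = x + a • 1 := by rw [hx, ← Algebra.algebraMap_eq_smul_one, sub_add_cancel]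
  have eu' : (↑u⁻¹ : A) = x' + a' • 1 := by
    rw [hx', ← Algebra.algebraMap_eq_smul_one, sub_add_cancel]
  have exx : x * x' = (1 - a * a') • (1 : A) - a' • x - a • x' := by
    have h : (x + a • 1) * (x' + a' • 1) = (1 : A) := by rw [← eu, ← eu', Units.mul_inv]
    simp only [add_mul, mul_add, smul_mul_assoc, mul_smul_comm, mul_one, one_mul] at h
    linear_combination (norm := module) h
  have exx' : x' * x = (1 - a * a') • (1 : A) - a' • x - a • x' := by
    have h : (x' + a' • 1) * (x + a • 1) = (1 : A) := by rw [← eu, ← eu', Units.inv_mul]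
    simp only [add_mul, mul_add, smul_mul_assoc, mul_smul_comm, mul_one, one_mul] at h
    linear_combination (norm := module) h
  set y : A := ↑t * x * ↑t⁻¹ with hy
  set y' : A := ↑t * x' * ↑t⁻¹ with hy'
  have hconj : ∀ b : A, b ∈ Z → ↑t * b * ↑t⁻¹ ∈ Z := by
    intro b hb
    refine hZ _ _ ?_
    rwa [← mul_assoc, Units.inv_mul, one_mul]
  have e1 : (↑t * u * ↑t⁻¹ : A) = y + a • 1 := by
    rw [eu, hy, mul_add, add_mul]; simp
  have e2 : (↑t * ↑u⁻¹ * ↑t⁻¹ : A) = y' + a' • 1 := by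
    rw [eu', hy', mul_add, add_mul]; simp
  -- The trace of `x y x'` is that of `x' x y`, and `x' x` is explicit.
  have hxyx : x * y * x' ∈ Z := by
    refine hZ _ _ ?_
    rw [← mul_assoc, exx']
    simp only [sub_mul, smul_mul_assoc, one_mul]
    exact sub_mem (sub_mem (Z.smul_mem _ (hconj _ ha)) (Z.smul_mem _ (red2 _ hxB ha _ hxB ha)))
      (Z.smul_mem _ (red2 _ hxB' ha' _ hxB ha))
  have hxxy : x * x' * y' ∈ Z := by
    rw [exx]
    simp only [sub_mul, smul_mul_assoc, one_mul]
    exact sub_mem (sub_mem (Z.smul_mem _ (hconj _ ha'))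
      (Z.smul_mem _ (red2 _ hxB ha _ hxB' ha'))) (Z.smul_mem _ (red2 _ hxB' ha' _ hxB' ha'))
  have hxyxy : x * y * x' * y' ∈ Z := red4 _ hxB ha _ hxB ha _ hxB' ha' _ hxB' ha'
  -- The term `v x' v⁻¹`, with `v = t u t⁻¹`, is a conjugate of `x'`.
  have hvxv : (y + a • 1) * x' * (y' + a' • 1) ∈ Z := by
    rw [← e1, ← e2]
    refine hZ (↑t * ↑u⁻¹ * ↑t⁻¹) (↑t * ↑u * ↑t⁻¹ * x') ?_
    convert ha' using 1
    simp [mul_assoc]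
  have e3 : (↑(u * (t * u * t⁻¹) * u⁻¹ * (t * u * t⁻¹)⁻¹) : A) =
      (x + a • 1) * (y + a • 1) * (x' + a' • 1) * (y' + a' • 1) := by
    rw [← e1, ← e2, ← eu, ← eu']
    simp [mul_assoc]
  have e4 : (y + a • 1) * (y' + a' • 1) = (1 : A) := by
    rw [← e1, ← e2]
    simp [mul_assoc]
  have e5 : (x + a • 1) * (y + a • 1) * (x' + a' • 1) * (y' + a' • 1) -
      algebraMap ℂ A (2 * (a * a') - (a * a') ^ 2) =
      a' • x + a • ((y + a • 1) * x' * (y' + a' • 1)) + (a * a') • ((-a') • x + (-a) • x') +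
        a • (x * x' * y') + a' • (x * y * x') + x * y * x' * y' := by
    have e6 : (x + a • 1) * (y + a • 1) * (x' + a' • 1) * (y' + a' • 1) =
        a' • ((x + a • 1) * ((y + a • 1) * (y' + a' • 1))) +
          a • ((y + a • 1) * x' * (y' + a' • 1)) + (a * a') • (x * x') + a • (x * x' * y') +
          a' • (x * y * x') + x * y * x' * y' := by
      simp only [add_mul, mul_add, smul_mul_assoc, mul_smul_comm, mul_one, one_mul, smul_add,
        smul_smul, mul_assoc]
      module
    rw [e6, e4, exx, Algebra.algebraMap_eq_smul_one, mul_one]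
    module
  rw [e3, e5]
  exact add_mem (add_mem (add_mem (add_mem (add_mem (Z.smul_mem _ ha) (Z.smul_mem _ hvxv))
    (Z.smul_mem _ (add_mem (Z.smul_mem _ ha) (Z.smul_mem _ ha')))) (Z.smul_mem _ hxxy))
    (Z.smul_mem _ hxyx)) hxyxy

end Freeness

/-! ### The trace on `LG` -/

theorem single_eq_translate_delta {G : Type v} [Group G] [DecidableEq G] (g : G) (c : ℂ) :
    (lp.single 2 g c : Ell2 G) = c • translate g (delta G) := by
  ext y
  unfold delta
  by_cases hy : y = g
  · subst hy; simp [lp.single_apply]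
  · have : g⁻¹ * y ≠ 1 := fun h => hy (inv_mul_eq_one.mp h).symm
    simp [lp.single_apply, hy, this]

theorem inner_delta {G : Type v} [Group G] (f : Ell2 G) :
    inner ℂ (delta G) f = (f : ∀ _ : G, ℂ) 1 := by
  classical
  have h := lp.inner_single_left (𝕜 := ℂ) (G := fun _ : G => ℂ) 1 (1 : ℂ) f
  unfold delta
  convert h using 1
  simp

theorem norm_delta {G : Type v} [Group G] : ‖delta G‖ = 1 := by
  classical
  have h := lp.norm_single (E := fun _ : G => ℂ) (p := 2) (by norm_num) 1 (1 : ℂ)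
  unfold delta
  convert h using 1
  simp

/-- The trace as a linear functional. -/
def traceHom (G : Type v) [Group G] : LG G →ₗ[ℂ] ℂ where
  toFun := trace
  map_add' x y := inner_add_right (delta G) ((x : Ell2 G →L[ℂ] Ell2 G) (delta G))
    ((y : Ell2 G →L[ℂ] Ell2 G) (delta G))
  map_smul' c x := inner_smul_right (delta G) ((x : Ell2 G →L[ℂ] Ell2 G) (delta G)) c

theorem traceHom_apply {G : Type v} [Group G] (x : LG G) : traceHom G x = trace x := rfl

theorem trace_one {G : Type v} [Group G] : trace (1 : LG G) = 1 := by
  change inner ℂ (delta G) (delta G) = 1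
  rw [inner_self_eq_norm_sq_to_K, norm_delta]
  simp

theorem trace_algebraMap {G : Type v} [Group G] (c : ℂ) :
    trace (algebraMap ℂ (LG G) c) = c := by
  rw [← traceHom_apply, Algebra.algebraMap_eq_smul_one, map_smul, traceHom_apply, trace_one,
    smul_eq_mul, mul_one]

theorem trace_star {G : Type v} [Group G] (x : LG G) :
    trace (star x) = (starRingEnd ℂ) (trace x) := by
  rw [trace, trace, inner_conj_symm]
  change inner ℂ (delta G) ((star (x : Ell2 G →L[ℂ] Ell2 G)) (delta G)) = _
  rw [ContinuousLinearMap.star_eq_adjoint, ContinuousLinearMap.adjoint_inner_right]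

theorem norm_trace_mul_le {G : Type v} [Group G] (x y : LG G) :
    ‖trace (x * y)‖ ≤ ‖(x : Ell2 G →L[ℂ] Ell2 G)‖ * twoNorm y := by
  rw [twoNorm_eq]
  refine (norm_inner_le_norm _ _).trans ?_
  rw [norm_delta, one_mul]
  exact (x : Ell2 G →L[ℂ] Ell2 G).le_opNorm _

theorem trace_groupUnitary_of_ne_one {G : Type v} [Group G] (g : G) (hg : g ≠ 1) :
    trace (groupUnitary G g : LG G) = 0 := by
  classical
  change inner ℂ (delta G) (translate g (delta G)) = 0
  rw [inner_delta, translate_apply, mul_one, delta]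
  simp [lp.single_apply, hg]

/-- The coefficient of `x δ₁` at `g` is the trace of `g⁻¹ x`. -/
theorem apply_delta_apply {G : Type v} [Group G] (x : LG G) (g : G) :
    ((x : Ell2 G →L[ℂ] Ell2 G) (delta G) : ∀ _ : G, ℂ) g =
      trace ((groupUnitary G g⁻¹ : LG G) * x) := by
  change _ = inner ℂ (delta G) (translate g⁻¹ ((x : Ell2 G →L[ℂ] Ell2 G) (delta G)))
  rw [inner_delta, translate_apply, inv_inv, mul_one]

theorem rightTranslate_delta {G : Type v} [Group G] (g : G) :
    rightTranslate g⁻¹ (delta G) = translate g (delta G) := by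
  classical
  ext y
  change (delta G : ∀ _ : G, ℂ) (y * g⁻¹) = (delta G : ∀ _ : G, ℂ) (g⁻¹ * y)
  unfold delta
  by_cases hy : y = g
  · subst hy; simp
  · have h1 : g⁻¹ * y ≠ 1 := fun h => hy (inv_mul_eq_one.mp h).symm
    have h2 : y * g⁻¹ ≠ 1 := fun h => hy (mul_inv_eq_one.mp h)
    simp [lp.single_apply, h1, h2]

theorem trace_mul_groupUnitary {G : Type v} [Group G] (x : LG G) (g : G) :
    trace (x * (groupUnitary G g : LG G)) = trace ((groupUnitary G g : LG G) * x) := by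
  change inner ℂ (delta G) ((x : Ell2 G →L[ℂ] Ell2 G) (translate g (delta G))) =
    inner ℂ (delta G) (translate g ((x : Ell2 G →L[ℂ] Ell2 G) (delta G)))
  rw [← rightTranslate_delta, rightTranslate_commute, inner_delta, inner_delta, translate_apply]
  change ((x : Ell2 G →L[ℂ] Ell2 G) (delta G) : ∀ _ : G, ℂ) (1 * g⁻¹) = _
  rw [one_mul, mul_one]

/-- Both traces equal the sum over `g` of the products of the coefficients at `g` and `g⁻¹`. -/
theorem trace_mul_comm {G : Type v} [Group G] (x y : LG G) : trace (x * y) = trace (y * x) := by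
  have key : ∀ x y : LG G, trace (x * y) = ∑' g : G,
      trace ((groupUnitary G g : LG G) * x) * trace ((groupUnitary G g⁻¹ : LG G) * y) := by
    intro x y
    have h : trace (x * y) = inner ℂ (((star x : LG G) : Ell2 G →L[ℂ] Ell2 G) (delta G))
        ((y : Ell2 G →L[ℂ] Ell2 G) (delta G)) := by
      change _ = inner ℂ ((star (x : Ell2 G →L[ℂ] Ell2 G)) (delta G)) _
      rw [ContinuousLinearMap.star_eq_adjoint, ContinuousLinearMap.adjoint_inner_left]
      rfl
    rw [h, lp.inner_eq_tsum]
    refine tsum_congr fun g => ?_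
    rw [apply_delta_apply, apply_delta_apply, RCLike.inner_apply, mul_comm]
    congr 1
    have e : (groupUnitary G g⁻¹ : LG G) * star x = star (x * (groupUnitary G g : LG G)) := by
      rw [star_mul, map_inv]
      rfl
    rw [e, trace_star, Complex.conj_conj, trace_mul_groupUnitary]
  rw [key x y, key y x, ← (Equiv.inv G).tsum_eq]
  refine tsum_congr fun g => ?_
  rw [Equiv.inv_apply, inv_inv, mul_comm]

/-! ### Generic group elements are free from `LG` -/

/-- The families of elements of `LG` whose traces tend to `0` along `F`. -/
def nullTrace {G : Type v} [Group G] (F : Filter G) : Submodule ℂ (G → LG G) where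
  carrier := {f | Tendsto (fun g => traceHom G (f g)) F (𝓝 0)}
  zero_mem' := by simpa using tendsto_const_nhds
  add_mem' {f₁ f₂} h₁ h₂ := by simpa using Tendsto.add h₁ h₂
  smul_mem' c f h := by simpa using Tendsto.const_mul c h

theorem mem_nullTrace {G : Type v} [Group G] {F : Filter G} {f : G → LG G} :
    f ∈ nullTrace F ↔ Tendsto (fun g => trace (f g)) F (𝓝 0) := Iff.rfl

theorem nullTrace_mul_comm {G : Type v} [Group G] (F : Filter G) (f₁ f₂ : G → LG G)
    (h : f₁ * f₂ ∈ nullTrace F) : f₂ * f₁ ∈ nullTrace F := by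
  rw [mem_nullTrace] at h ⊢
  simpa only [Pi.mul_apply, trace_mul_comm] using h

theorem const_mem_nullTrace {G : Type v} [Group G] {F : Filter G} [F.NeBot] (x : LG G) :
    Function.const G x ∈ nullTrace F ↔ trace x = 0 := by
  rw [mem_nullTrace]
  change Tendsto (fun _ : G => trace x) F (𝓝 0) ↔ _
  exact tendsto_const_nhds_iff

theorem one_notMem_nullTrace {G : Type v} [Group G] (F : Filter G) [F.NeBot] :
    (1 : G → LG G) ∉ nullTrace F := by
  intro h
  have h1 := (const_mem_nullTrace (F := F) (1 : LG G)).mp h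
  rw [trace_one] at h1
  exact one_ne_zero h1

/-- The family of unitaries `g ↦ λ_g`: the generic group element. -/
def genericUnit (G : Type v) [Group G] : (G → LG G)ˣ :=
  MulEquiv.piUnits.symm fun g => Unitary.toUnits (groupUnitary G g)

theorem genericUnit_zpow_apply {G : Type v} [Group G] (k : ℤ) (g : G) :
    (↑(genericUnit G ^ k) : G → LG G) g = (groupUnitary G (g ^ k) : LG G) := by
  rw [genericUnit, ← map_zpow, map_zpow (groupUnitary G)]
  change (((fun g => Unitary.toUnits (groupUnitary G g)) ^ k) g : (LG G)ˣ).val = _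
  rw [Pi.pow_apply, ← map_zpow]
  rfl

/-- The constant families. -/
def constants (G : Type v) [Group G] : Subalgebra ℂ (G → LG G) :=
  (Pi.constAlgHom ℂ G (LG G)).range

/-- Families bounded in operator norm. -/
def OpBounded {G : Type v} [Group G] (f : G → LG G) : Prop :=
  ∃ C : ℝ, ∀ g, ‖(f g : Ell2 G →L[ℂ] Ell2 G)‖ ≤ C

theorem OpBounded.mul {G : Type v} [Group G] {f₁ f₂ : G → LG G} (h₁ : OpBounded f₁)
    (h₂ : OpBounded f₂) : OpBounded (f₁ * f₂) := by
  obtain ⟨C₁, h₁⟩ := h₁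
  obtain ⟨C₂, h₂⟩ := h₂
  refine ⟨C₁ * C₂, fun g => (norm_mul_le (f₁ g : Ell2 G →L[ℂ] Ell2 G) _).trans ?_⟩
  exact mul_le_mul (h₁ g) (h₂ g) (norm_nonneg _) ((norm_nonneg _).trans (h₁ g))

theorem opBounded_groupUnitary {G : Type v} [Group G] (φ : G → G) :
    OpBounded fun g => (groupUnitary G (φ g) : LG G) :=
  ⟨1, fun g => (translate (φ g)).norm_toContinuousLinearMap_le⟩

theorem opBounded_genericUnit_zpow {G : Type v} [Group G] (k : ℤ) :
    OpBounded (↑(genericUnit G ^ k) : G → LG G) := by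
  convert opBounded_groupUnitary fun g : G => g ^ k using 1
  ext1 g
  exact genericUnit_zpow_apply k g

/-- Elements of trace zero are limits in the 2-norm of combinations of non-trivial group
elements. -/
theorem exists_sum_twoNorm_sub_lt {G : Type v} [Group G] (x : LG G) (hx : trace x = 0) {ε : ℝ}
    (hε : 0 < ε) : ∃ y ∈ Submodule.span ℂ {y : LG G | ∃ h : G, h ≠ 1 ∧ y = groupUnitary G h},
      twoNorm (x - y) < ε := by
  classical
  set f := (x : Ell2 G →L[ℂ] Ell2 G) (delta G) with hf
  have h1 := lp.hasSum_single (p := 2) (by norm_num) f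
  obtain ⟨s, hs⟩ := (Metric.tendsto_nhds.mp h1 ε hε).exists
  refine ⟨∑ h ∈ s, (f : ∀ _ : G, ℂ) h • (groupUnitary G h : LG G),
    Submodule.sum_mem _ fun h _ => ?_, ?_⟩
  · by_cases hh : h = 1
    · have h2 : (f : ∀ _ : G, ℂ) h = 0 := by
        rw [hh, hf, ← inner_delta]
        exact hx
      rw [h2, zero_smul]
      exact zero_mem _
    · exact Submodule.smul_mem _ _ (Submodule.subset_span ⟨h, hh, rfl⟩)
  · rw [twoNorm_eq]
    rw [dist_eq_norm, norm_sub_rev] at hs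
    refine lt_of_eq_of_lt (congrArg norm ?_) hs
    change ((x : Ell2 G →L[ℂ] Ell2 G) - ((∑ h ∈ s, (f : ∀ _ : G, ℂ) h •
      (groupUnitary G h : LG G) : LG G) : Ell2 G →L[ℂ] Ell2 G)) (delta G) = _
    rw [_root_.sub_apply, ← hf, AddSubmonoidClass.coe_finsetSum,
      _root_.sum_apply]
    congr 1
    refine Finset.sum_congr rfl fun h _ => ?_
    exact (single_eq_translate_delta h ((f : ∀ _ : G, ℂ) h)).symm

/-- To show that `p x r` has null trace for every `x ∈ LG` of trace zero, where `p` and `r` are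
bounded families, it suffices to let `x` be a non-trivial group element. By the trace property only
the 2-norm of the error matters. -/
theorem mul_const_mul_mem_nullTrace {G : Type v} [Group G] {F : Filter G} (p r : G → LG G)
    (hp : OpBounded p) (hr : OpBounded r)
    (h : ∀ h : G, h ≠ 1 → (p * (Function.const G (groupUnitary G h : LG G) * r)) ∈ nullTrace F)
    (x : LG G) (hx : trace x = 0) : (p * (Function.const G x * r)) ∈ nullTrace F := by
  obtain ⟨C, hC⟩ := hr.mul hp
  have hspan : ∀ y ∈ Submodule.span ℂ {y : LG G | ∃ h : G, h ≠ 1 ∧ y = groupUnitary G h},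
      (p * (Function.const G y * r)) ∈ nullTrace F := by
    intro y hy
    induction hy using Submodule.span_induction with
    | mem y hy =>
      obtain ⟨k, hk, rfl⟩ := hy
      exact h k hk
    | zero =>
      convert zero_mem (nullTrace F)
      ext1 g
      simp
    | add y z _ _ hy hz =>
      convert add_mem hy hz using 1
      ext1 g
      simp [mul_add, add_mul]
    | smul c y _ hy =>
      convert Submodule.smul_mem _ c hy using 1
      ext1 g
      simp
  rw [mem_nullTrace, Metric.tendsto_nhds]
  intro ε hε
  have hC' : 0 < |C| + 1 := by positivity
  obtain ⟨y, hy, hxy⟩ := exists_sum_twoNorm_sub_lt x hx (ε := ε / 2 / (|C| + 1)) (by positivity)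
  filter_upwards [Metric.tendsto_nhds.mp (mem_nullTrace.mp (hspan y hy)) (ε / 2) (by positivity)]
    with g hg
  rw [dist_zero_right] at hg ⊢
  have e : trace ((p * (Function.const G x * r)) g) =
      trace (r g * p g * (x - y)) + trace ((p * (Function.const G y * r)) g) := by
    have e1 : ∀ z : LG G,
        trace ((p * (Function.const G z * r)) g) = traceHom G (r g * p g * z) := by
      intro z
      change trace (p g * (z * r g)) = trace (r g * p g * z)
      rw [← mul_assoc, trace_mul_comm, ← mul_assoc]
    rw [e1, e1, ← traceHom_apply, mul_sub, map_sub, sub_add_cancel]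
  have h1 : ‖trace (r g * p g * (x - y))‖ < ε / 2 := by
    refine (norm_trace_mul_le _ _).trans_lt ?_
    have h2 : ‖((r g * p g : LG G) : Ell2 G →L[ℂ] Ell2 G)‖ ≤ |C| + 1 :=
      (hC g).trans ((le_abs_self C).trans (by linarith))
    calc _ ≤ (|C| + 1) * twoNorm (x - y) := mul_le_mul_of_nonneg_right h2 (twoNorm_nonneg _)
      _ < (|C| + 1) * (ε / 2 / (|C| + 1)) := mul_lt_mul_of_pos_left hxy hC'
      _ = ε / 2 := by field_simp
  rw [e]
  linarith [norm_add_le (trace (r g * p g * (x - y))) (trace ((p * (Function.const G y * r)) g))]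

theorem Reduced.opBounded {G : Type v} [Group G] {Z : Submodule ℂ (G → LG G)} {r : G → LG G}
    (hr : Reduced Z (constants G) (genericUnit G) r) : OpBounded r := by
  have hconst : ∀ b ∈ constants G, OpBounded b := by
    rintro _ ⟨x, rfl⟩
    exact ⟨‖(x : Ell2 G →L[ℂ] Ell2 G)‖, fun _ => le_rfl⟩
  induction hr with
  | single b hb hZ k => exact (hconst b hb).mul (opBounded_genericUnit_zpow k)
  | cons b hb hZ k hk r _ ih => exact (hconst b hb).mul ((opBounded_genericUnit_zpow k).mul ih)

/-- The family `g ↦ λ_{x(g)}` obtained by substituting generic elements into a mixed word `x`. -/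
def wordFamily {G : Type v} [Group G] (x : MixedWord G) : G → LG G :=
  fun g => (groupUnitary G (wordAt g x) : LG G)

theorem wordFamily_mem_nullTrace {G : Type v} [Group G] (x : MixedWord G) (hx : x ≠ 1) :
    wordFamily x ∈ nullTrace (genericFilter G) := by
  rw [mem_nullTrace]
  refine tendsto_const_nhds.congr' ?_
  filter_upwards [eventually_wordAt_ne_one x hx] with g hg
  exact (trace_groupUnitary_of_ne_one _ hg).symm

theorem wordFamily_mul_coeff_mul_genPow {G : Type v} [Group G] (x : MixedWord G) (h : G) (k : ℤ) :
    wordFamily (x * coeff h * genPow k) =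
      wordFamily x *
        (Function.const G (groupUnitary G h : LG G) * (↑(genericUnit G ^ k) : G → LG G)) := by
  ext1 g
  simp only [wordFamily, map_mul, wordAt_coeff, wordAt_genPow, Pi.mul_apply,
    Function.const_apply, genericUnit_zpow_apply, Submonoid.coe_mul, mul_assoc]

/-- Reduced products of centred elements of `LG` and powers of a generic group element have null
trace, also after a prefix of group letters. The letters from `LG` are approximated one at a time
from left to right, each by group letters that then join the prefix; the precision may depend on
all other letters, so no uniform bound on the operator norms of the approximants is needed. -/
theorem Reduced.wordFamily_mul_mem_nullTrace {G : Type v} [Group G] [(genericFilter G).NeBot]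
    {r : G → LG G}
    (hr : Reduced (nullTrace (genericFilter G)) (constants G) (genericUnit G) r) :
    ∀ x : MixedWord G,
      (x = 1 ∨ ∃ w : CoprodI.NeWord (Letter G) false true, w.prod = x) →
      wordFamily x * r ∈ nullTrace (genericFilter G) := by
  have hcoeff : ∀ x : MixedWord G,
      (x = 1 ∨ ∃ w : CoprodI.NeWord (Letter G) false true, w.prod = x) →
      ∀ h : G, h ≠ 1 →
      ∃ w : CoprodI.NeWord (Letter G) false false, w.prod = x * coeff h := by
    rintro x (rfl | ⟨w, rfl⟩) h hh
    · exact ⟨coeffWord h hh, by rw [coeffWord_prod, one_mul]⟩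
    · exact ⟨w.append (by decide) (coeffWord h hh), by
        rw [CoprodI.NeWord.append_prod, coeffWord_prod]⟩
  induction hr with
  | single b hb hZ k =>
    intro x hx
    obtain ⟨b, rfl⟩ := hb
    refine mul_const_mul_mem_nullTrace (wordFamily x) _ (opBounded_groupUnitary _)
      (opBounded_genericUnit_zpow k) (fun h hh => ?_) b
      ((const_mem_nullTrace (F := genericFilter G) b).mp hZ)
    obtain ⟨w, hw⟩ := hcoeff x hx h hh
    rw [← wordFamily_mul_coeff_mul_genPow, ← hw]
    refine wordFamily_mem_nullTrace _ ?_
    by_cases hk : k = 0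
    · have : (genPow k : MixedWord G) = 1 := by rw [hk]; exact map_one _
      rw [this, mul_one]
      exact neWord_prod_ne_one w
    · rw [← powWord_prod k hk, ← CoprodI.NeWord.append_prod (hne := by decide)]
      exact neWord_prod_ne_one _
  | cons b hb hZ k hk r hr ih =>
    intro x hx
    obtain ⟨b, rfl⟩ := hb
    refine mul_const_mul_mem_nullTrace (wordFamily x) _ (opBounded_groupUnitary _)
      ((opBounded_genericUnit_zpow k).mul hr.opBounded)
      (fun h hh => ?_) b ((const_mem_nullTrace (F := genericFilter G) b).mp hZ)
    obtain ⟨w, hw⟩ := hcoeff x hx h hh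
    rw [← mul_assoc (Function.const G _), ← mul_assoc, ← wordFamily_mul_coeff_mul_genPow]
    refine ih _ (Or.inr ⟨w.append (by decide) (powWord G k hk), ?_⟩)
    rw [CoprodI.NeWord.append_prod, powWord_prod, hw]

/-- If the filter of generic substitutions is proper, `LG` is free from the generic group
element. -/
theorem freeFrom_constants (G : Type v) [Group G] [(genericFilter G).NeBot] :
    FreeFrom (nullTrace (genericFilter G)) (constants G) (genericUnit G) where
  exists_scalar := by
    rintro _ ⟨x, rfl⟩
    refine ⟨trace x, ?_⟩
    refine (const_mem_nullTrace (F := genericFilter G) (x - algebraMap ℂ (LG G) (trace x))).mpr ?_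
    rw [← traceHom_apply, map_sub, traceHom_apply, traceHom_apply, trace_algebraMap, sub_self]
  reduced_mem r hr := by
    have h := hr.wordFamily_mul_mem_nullTrace 1 (Or.inl rfl)
    have e : wordFamily (1 : MixedWord G) = 1 := by
      ext1 g
      simp [wordFamily]
    rwa [e, one_mul] at h

/-! ### Scalars and lengths in terms of the trace -/

theorem distScalar_sq {G : Type v} [Group G] (u : unitary (LG G)) (z : Circle) :
    distScalar u z ^ 2 = 2 - 2 * ((starRingEnd ℂ) (z : ℂ) * trace (u : LG G)).re := by
  have h1 : ‖((u : LG G) : Ell2 G →L[ℂ] Ell2 G) (delta G)‖ = 1 := by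
    have h := twoNorm_unitary_mul u 1
    rw [mul_one, twoNorm_eq, twoNorm_eq] at h
    exact h.trans norm_delta
  have h2 : distScalar u z =
      ‖(z : ℂ) • delta G - ((u : LG G) : Ell2 G →L[ℂ] Ell2 G) (delta G)‖ := by
    rw [distScalar, twoNorm_eq]
    rfl
  rw [h2, @norm_sub_sq ℂ, h1, norm_smul, norm_delta, Circle.norm_coe, inner_smul_left]
  change (1 * 1) ^ 2 - 2 * ((starRingEnd ℂ) (z : ℂ) * trace (u : LG G)).re + 1 ^ 2 = _
  ring

theorem length_sq {G : Type v} [Group G] (u : unitary (LG G)) :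
    length u ^ 2 = 2 - 2 * (trace (u : LG G)).re := by
  have h := distScalar_sq u 1
  rw [distScalar, Circle.coe_one, map_one, map_one, one_mul] at h
  exact h

theorem preProjLength_le_length {G : Type v} [Group G] (u : unitary (LG G)) :
    preProjLength u ≤ length u := by
  have h := preProjLength_le u 1
  rwa [distScalar, Circle.coe_one, map_one] at h

theorem preProjLength_of_mem_scalars {G : Type v} [Group G] {u : unitary (LG G)}
    (hu : u ∈ scalars G) : preProjLength u = 0 := by
  obtain ⟨z, rfl⟩ := hu
  rw [← one_mul (scalarHom G z), preProjLength_mul_scalar, preProjLength_one]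

/-- The equality case of `|τ(u)| ≤ 1`. -/
theorem norm_trace_lt_one {G : Type v} [Group G] {u : unitary (LG G)} (hu : u ∉ scalars G) :
    ‖trace (u : LG G)‖ < 1 := by
  have h1 : ‖trace (u : LG G)‖ ≤ 1 := by
    have h := norm_trace_mul_le 1 (u : LG G)
    rw [one_mul] at h
    refine h.trans ?_
    have h2 := twoNorm_unitary_mul u 1
    rw [mul_one] at h2
    rw [h2, twoNorm_eq]
    change ‖(1 : Ell2 G →L[ℂ] Ell2 G)‖ * ‖delta G‖ ≤ 1
    rw [norm_delta, mul_one]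
    exact ContinuousLinearMap.norm_id_le
  refine lt_of_le_of_ne h1 fun h => hu (mem_scalars_of_preProjLength u ?_)
  refine le_antisymm ?_ (le_ciInf fun z => twoNorm_nonneg _)
  have h3 := distScalar_sq u ⟨trace (u : LG G), mem_sphere_zero_iff_norm.mpr h⟩
  have h4 : (starRingEnd ℂ) (trace (u : LG G)) * trace (u : LG G) = 1 := by
    rw [mul_comm, Complex.mul_conj, Complex.normSq_eq_norm_sq, h]
    norm_num
  have h5 := h3.trans (congrArg (fun c : ℂ => 2 - 2 * c.re) h4)
  rw [Complex.one_re, mul_one, sub_self] at h5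
  exact (preProjLength_le u _).trans (pow_eq_zero_iff two_ne_zero |>.mp h5).le

theorem notMem_scalars_of_norm_trace_lt_one {G : Type v} [Group G] {u : unitary (LG G)}
    (hu : ‖trace (u : LG G)‖ < 1) : u ∉ scalars G := by
  rintro ⟨z, rfl⟩
  refine hu.ne ?_
  change ‖trace (algebraMap ℂ (LG G) z)‖ = 1
  rw [trace_algebraMap, Circle.norm_coe]

/-! ### Iterated commutators -/

/-- The words `w₀ = x₀` and `wₙ₊₁ = [wₙ, t wₙ t⁻¹]` with `t = x₁ ^ 2 ^ n`. -/
def commWord : ℕ → FreeGroup (Fin 2)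
  | 0 => FreeGroup.of 0
  | n + 1 => commWord n * (FreeGroup.of 1 ^ 2 ^ n * commWord n * (FreeGroup.of 1 ^ 2 ^ n)⁻¹) *
      (commWord n)⁻¹ * (FreeGroup.of 1 ^ 2 ^ n * commWord n * (FreeGroup.of 1 ^ 2 ^ n)⁻¹)⁻¹

/-- The algebras containing the values of `commWord n` at a constant and the generic unit; the
`n`-th one is generated by the conjugates of the constants by `t ^ i`, `0 ≤ i < 2 ^ n`. -/
def algTower (G : Type v) [Group G] : ℕ → Subalgebra ℂ (G → LG G)
  | 0 => constants G
  | n + 1 => adjoinConj (algTower G n) (genericUnit G ^ 2 ^ n)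

/-- The value of a word at `u` and the generic unit. -/
def wordUnit {G : Type v} [Group G] (u : unitary (LG G)) : FreeGroup (Fin 2) →* (G → LG G)ˣ :=
  FreeGroup.lift ![MulEquiv.piUnits.symm fun _ => Unitary.toUnits u, genericUnit G]

theorem wordUnit_apply {G : Type v} [Group G] (u : unitary (LG G)) (w : FreeGroup (Fin 2))
    (g : G) : (wordUnit u w : G → LG G) g = (wordEval u g w : LG G) := by
  have h : ((Pi.evalMonoidHom (fun _ : G => (LG G)ˣ) g).comp
      (MulEquiv.piUnits : (G → LG G)ˣ ≃* _).toMonoidHom).comp (wordUnit u) =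
      Unitary.toUnits.comp (wordEval u g) := by
    apply FreeGroup.ext_hom
    intro i
    fin_cases i <;> rfl
  exact congrArg Units.val (DFunLike.congr_fun h w)

theorem freeFrom_algTower (G : Type v) [Group G] [(genericFilter G).NeBot] (n : ℕ) :
    FreeFrom (nullTrace (genericFilter G)) (algTower G n) (genericUnit G ^ 2 ^ n) := by
  induction n with
  | zero =>
    rw [pow_zero, pow_one]
    exact freeFrom_constants G
  | succ n ih =>
    rw [pow_succ, pow_mul]
    exact ih.sq (nullTrace_mul_comm _) (one_notMem_nullTrace _)

theorem commutator_mem_adjoinConj {A : Type*} [Ring A] [Algebra ℂ A] (B : Subalgebra ℂ A)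
    (t u : Aˣ) (hu : (u : A) ∈ B) (hu' : (↑u⁻¹ : A) ∈ B) :
    (↑(u * (t * u * t⁻¹) * u⁻¹ * (t * u * t⁻¹)⁻¹) : A) ∈ adjoinConj B t ∧
      (↑(u * (t * u * t⁻¹) * u⁻¹ * (t * u * t⁻¹)⁻¹)⁻¹ : A) ∈ adjoinConj B t := by
  have h1 : ∀ b ∈ B, b ∈ adjoinConj B t := fun b hb => Algebra.subset_adjoin (Or.inl hb)
  have h2 : ∀ b ∈ B, ↑t * b * ↑t⁻¹ ∈ adjoinConj B t := fun b hb =>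
    Algebra.subset_adjoin (Or.inr ⟨b, hb, rfl⟩)
  constructor
  · convert mul_mem (mul_mem (mul_mem (h1 _ hu) (h2 _ hu)) (h1 _ hu')) (h2 _ hu') using 1
    simp [mul_assoc]
  · convert mul_mem (mul_mem (mul_mem (h2 _ hu) (h1 _ hu)) (h2 _ hu')) (h1 _ hu') using 1
    simp [mul_assoc]

theorem wordUnit_commWord_succ {G : Type v} [Group G] (u : unitary (LG G)) (n : ℕ) :
    wordUnit u (commWord (n + 1)) = wordUnit u (commWord n) *
      (genericUnit G ^ 2 ^ n * wordUnit u (commWord n) * (genericUnit G ^ 2 ^ n)⁻¹) *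
      (wordUnit u (commWord n))⁻¹ *
      (genericUnit G ^ 2 ^ n * wordUnit u (commWord n) * (genericUnit G ^ 2 ^ n)⁻¹)⁻¹ := by
  have h : wordUnit u (FreeGroup.of 1) = genericUnit G := by
    rw [wordUnit, FreeGroup.lift_apply_of]
    rfl
  simp only [commWord, map_mul, map_inv, map_pow, h]

theorem wordUnit_commWord_mem {G : Type v} [Group G] (u : unitary (LG G)) (n : ℕ) :
    (wordUnit u (commWord n) : G → LG G) ∈ algTower G n ∧
      (↑(wordUnit u (commWord n))⁻¹ : G → LG G) ∈ algTower G n := by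
  induction n with
  | zero =>
    have h : wordUnit u (commWord 0) = MulEquiv.piUnits.symm fun _ => Unitary.toUnits u := by
      rw [wordUnit, commWord, FreeGroup.lift_apply_of]
      rfl
    rw [h]
    exact ⟨⟨(u : LG G), rfl⟩, ⟨((u⁻¹ : unitary (LG G)) : LG G), rfl⟩⟩
  | succ n ih =>
    rw [wordUnit_commWord_succ]
    exact commutator_mem_adjoinConj _ _ _ ih.1 ih.2

theorem wordUnit_inv_sub_mem {G : Type v} [Group G] {F : Filter G} (u : unitary (LG G))
    (w : FreeGroup (Fin 2)) (a : ℂ)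
    (h : (wordUnit u w : G → LG G) - algebraMap ℂ (G → LG G) a ∈ nullTrace F) :
    (↑(wordUnit u w)⁻¹ : G → LG G) - algebraMap ℂ (G → LG G) ((starRingEnd ℂ) a) ∈
      nullTrace F := by
  rw [mem_nullTrace] at h ⊢
  have h1 := (Complex.continuous_conj.tendsto _).comp h
  rw [map_zero] at h1
  refine h1.congr fun g => ?_
  rw [Function.comp_apply, ← trace_star, Pi.sub_apply, Pi.sub_apply, star_sub, wordUnit_apply,
    ← map_inv, wordUnit_apply, map_inv, Pi.algebraMap_apply, Pi.algebraMap_apply,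
    ← algebraMap_star_comm]
  rfl

/-- The limits of the traces of the iterated commutators, in terms of the trace `a` of `u`. -/
def traceSeq (a : ℂ) : ℕ → ℂ
  | 0 => a
  | n + 1 => 2 * (traceSeq a n * (starRingEnd ℂ) (traceSeq a n)) -
      (traceSeq a n * (starRingEnd ℂ) (traceSeq a n)) ^ 2

theorem wordUnit_commWord_sub_mem {G : Type v} [Group G] [(genericFilter G).NeBot]
    (u : unitary (LG G)) (n : ℕ) :
    (wordUnit u (commWord n) : G → LG G) -
      algebraMap ℂ (G → LG G) (traceSeq (trace (u : LG G)) n) ∈ nullTrace (genericFilter G) := by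
  induction n with
  | zero =>
    have h : (wordUnit u (commWord 0) : G → LG G) - algebraMap ℂ (G → LG G) (trace (u : LG G)) =
        Function.const G ((u : LG G) - algebraMap ℂ (LG G) (trace (u : LG G))) := by
      ext1 g
      rw [Pi.sub_apply, wordUnit_apply, wordEval, commWord, FreeGroup.lift_apply_of]
      rfl
    rw [traceSeq, h, const_mem_nullTrace, ← traceHom_apply, map_sub, traceHom_apply,
      traceHom_apply, trace_algebraMap, sub_self]
  | succ n ih =>
    rw [wordUnit_commWord_succ]
    exact (freeFrom_algTower G n).commutator_sub_mem (nullTrace_mul_comm _) _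
      (wordUnit_commWord_mem u n).1 (wordUnit_commWord_mem u n).2 _ _ ih
      (wordUnit_inv_sub_mem u _ _ ih)

theorem tendsto_trace_commWord {G : Type v} [Group G] [(genericFilter G).NeBot]
    (u : unitary (LG G)) (n : ℕ) :
    Tendsto (fun g => trace (wordEval u g (commWord n) : LG G)) (genericFilter G)
      (𝓝 (traceSeq (trace (u : LG G)) n)) := by
  rw [← tendsto_sub_nhds_zero_iff]
  refine (mem_nullTrace.mp (wordUnit_commWord_sub_mem u n)).congr fun g => ?_
  rw [Pi.sub_apply, wordUnit_apply, Pi.algebraMap_apply, ← traceHom_apply, map_sub,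
    traceHom_apply, traceHom_apply, trace_algebraMap]

theorem traceSeq_succ (a : ℂ) (n : ℕ) :
    traceSeq a (n + 1) = ((2 * ‖traceSeq a n‖ ^ 2 - ‖traceSeq a n‖ ^ 4 : ℝ) : ℂ) := by
  rw [traceSeq, Complex.mul_conj, Complex.normSq_eq_norm_sq]
  push_cast
  ring

theorem norm_traceSeq_succ (a : ℂ) (n : ℕ) (h : ‖traceSeq a n‖ ≤ 1) :
    ‖traceSeq a (n + 1)‖ = 2 * ‖traceSeq a n‖ ^ 2 - ‖traceSeq a n‖ ^ 4 := by
  rw [traceSeq_succ, Complex.norm_real, Real.norm_of_nonneg]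
  have h1 : ‖traceSeq a n‖ ^ 2 ≤ 1 := pow_le_one₀ (norm_nonneg _) h
  nlinarith [sq_nonneg ‖traceSeq a n‖]

/-- The defect `d = 1 - |a|` is replaced by `d ^ 2 (1 + |a|) ^ 2 ≤ 4 d ^ 2` at each step, so it
decays geometrically if it starts below `1 / 4`. -/
theorem traceSeq_bounds (a : ℂ) (h1 : ‖a‖ < 1) (h2 : 3 / 4 < ‖a‖) (n : ℕ) :
    ‖traceSeq a n‖ < 1 ∧ 1 - ‖traceSeq a n‖ ≤ (4 * (1 - ‖a‖)) ^ n * (1 - ‖a‖) := by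
  induction n with
  | zero => exact ⟨h1, by simp [traceSeq]⟩
  | succ n ih =>
    obtain ⟨ih1, ih2⟩ := ih
    rw [norm_traceSeq_succ a n ih1.le]
    set r := ‖traceSeq a n‖ with hr
    have hr0 : 0 ≤ r := norm_nonneg _
    have hd : 1 - r ≤ 1 - ‖a‖ := by
      refine ih2.trans ?_
      have := pow_le_one₀ (n := n) (a := 4 * (1 - ‖a‖)) (by linarith) (by linarith)
      nlinarith
    have hfac : 1 - (2 * r ^ 2 - r ^ 4) = ((1 - r) * (1 + r)) ^ 2 := by ring
    constructor
    · have : 0 < ((1 - r) * (1 + r)) ^ 2 := by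
        have : 0 < 1 - r := by linarith
        positivity
      linarith
    · rw [hfac, mul_pow]
      have h3 : (1 + r) ^ 2 ≤ 4 := by nlinarith
      calc (1 - r) ^ 2 * (1 + r) ^ 2 ≤ (1 - r) ^ 2 * 4 := by gcongr
        _ = 4 * (1 - r) * (1 - r) := by ring
        _ ≤ 4 * (1 - ‖a‖) * ((4 * (1 - ‖a‖)) ^ n * (1 - ‖a‖)) :=
            mul_le_mul (by linarith) ih2 (by linarith) (by linarith)
        _ = (4 * (1 - ‖a‖)) ^ (n + 1) * (1 - ‖a‖) := by ring

theorem tendsto_traceSeq (a : ℂ) (h1 : ‖a‖ < 1) (h2 : 3 / 4 < ‖a‖) :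
    Tendsto (fun n => ‖traceSeq a n‖) atTop (𝓝 1) := by
  have h := (tendsto_pow_atTop_nhds_zero_of_lt_one (r := 4 * (1 - ‖a‖)) (by linarith)
    (by linarith)).mul_const (1 - ‖a‖)
  rw [zero_mul] at h
  have h3 : Tendsto (fun n => 1 - ‖traceSeq a n‖) atTop (𝓝 0) :=
    squeeze_zero (fun n => by linarith [(traceSeq_bounds a h1 h2 n).1])
      (fun n => (traceSeq_bounds a h1 h2 n).2) h
  simpa using h3.const_sub 1

/-- A single generic group element makes an iterated commutator non-scalar and close to `1`. -/
theorem IsMIF.exists_word_length_lt {G : Type v} [Group G] (hG : IsMIF G) (u : unitary (LG G))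
    (hu : u ∉ scalars G) (hτ : 3 / 4 < (trace (u : LG G)).re) (ε : ℝ) (hε : 0 < ε) :
    ∃ (w : FreeGroup (Fin 2)) (g : G), wordEval u g w ∉ scalars G ∧
      length (wordEval u g w) < ε := by
  have := hG.neBot_genericFilter
  have h1 := norm_trace_lt_one hu
  have h2 := hτ.trans_le (Complex.re_le_norm _)
  obtain ⟨n, hn⟩ := (((tendsto_add_atTop_iff_nat 1).mpr (tendsto_traceSeq _ h1 h2)).eventually
    (lt_mem_nhds (show 1 - ε ^ 2 / 2 < 1 by have := sq_pos_of_pos hε; linarith))).exists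
  have hlt := (traceSeq_bounds _ h1 h2 (n + 1)).1
  have hre : (traceSeq (trace (u : LG G)) (n + 1)).re = ‖traceSeq (trace (u : LG G)) (n + 1)‖ := by
    rw [norm_traceSeq_succ _ n (traceSeq_bounds _ h1 h2 n).1.le, traceSeq_succ, Complex.ofReal_re]
  have ht := tendsto_trace_commWord u (n + 1)
  rw [← hre] at hn
  obtain ⟨g, hg1, hg2⟩ := ((ht.norm.eventually (gt_mem_nhds hlt)).and
    (((Complex.continuous_re.tendsto _).comp ht).eventually (lt_mem_nhds hn))).exists
  refine ⟨commWord (n + 1), g, notMem_scalars_of_norm_trace_lt_one hg1, ?_⟩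
  refine lt_of_pow_lt_pow_left₀ 2 hε.le ?_
  rw [length_sq]
  simp only [Function.comp_apply] at hg2
  linarith

/-! ### Discrete subgroups of the projective unitary group -/

theorem projLength_pos {G : Type v} [Group G] {x : PU G} (hx : x ≠ 1) : 0 < projLength x := by
  obtain ⟨u, rfl⟩ := toPU_surjective x
  refine lt_of_le_of_ne (le_ciInf fun z => twoNorm_nonneg _) fun h => hx ?_
  exact (QuotientGroup.eq_one_iff u).mpr (mem_scalars_of_preProjLength u h.symm)

theorem exists_projLength_bound_of_discrete {G : Type v} [Group G] (Γ : Subgroup (PU G))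
    [DiscreteTopology Γ] : ∃ ε > 0, ∀ x ∈ Γ, projLength x < ε → x = 1 := by
  obtain ⟨ε, hε, h⟩ := Metric.isOpen_iff.mp (isOpen_discrete ({1} : Set Γ)) 1 rfl
  refine ⟨ε, hε, fun x hx hlt => ?_⟩
  have h1 : (⟨x, hx⟩ : Γ) ∈ Metric.ball (1 : Γ) ε := by
    rw [Metric.mem_ball, dist_comm]
    change projLength ((1 : PU G)⁻¹ * x) < ε
    rwa [inv_one, one_mul]
  exact congrArg Subtype.val (h h1)

theorem toPU_wordEval_mem {G : Type v} [Group G] (u : unitary (LG G)) (g : G)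
    (w : FreeGroup (Fin 2)) (Γ : Subgroup (PU G)) (hu : toPU G u ∈ Γ) (hg : groupToPU G g ∈ Γ) :
    toPU G (wordEval u g w) ∈ Γ := by
  have h : ((toPU G).comp (wordEval u g)).range ≤ Γ := by
    have e : (toPU G).comp (wordEval u g) = FreeGroup.lift ![toPU G u, groupToPU G g] := by
      apply FreeGroup.ext_hom
      intro i
      fin_cases i <;> simp [wordEval, groupToPU]
    rw [e]
    apply FreeGroup.range_lift_le
    rintro _ ⟨i, rfl⟩
    fin_cases i
    · exact hu
    · exact hg
  exact h ⟨w, rfl⟩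

/-- The lift of `x` nearest to `1` has trace of real part `1 - ℓ̄(x)² / 2 > 3 / 4`, so iterated
commutators give non-trivial elements of the subgroup arbitrarily close to `1`. -/
theorem IsMIF.not_discreteTopology_closure {G : Type v} [Group G] (hG : IsMIF G) (x : PU G)
    (hx0 : 0 < projLength x) (hx : projLength x < 1 / √2) :
    ¬ DiscreteTopology ↥(Subgroup.closure (insert x (Set.range (groupToPU G)))) := by
  intro hdisc
  obtain ⟨ε, hε, hbound⟩ := exists_projLength_bound_of_discrete
    (Subgroup.closure (insert x (Set.range (groupToPU G))))
  obtain ⟨u, rfl⟩ := toPU_surjective x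
  rw [projLength_toPU] at hx hx0
  obtain ⟨z, hz⟩ := exists_preProjLength_eq u
  set v := u * scalarHom G z⁻¹ with hv
  have hvu : toPU G v = toPU G u := by
    have h : toPU G (scalarHom G z⁻¹) = 1 := (QuotientGroup.eq_one_iff _).mpr ⟨z⁻¹, rfl⟩
    rw [hv, map_mul, h, mul_one]
  have hvs : v ∉ scalars G := fun h => by
    rw [← preProjLength_mul_scalar u z⁻¹, preProjLength_of_mem_scalars h] at hx0
    exact hx0.false
  have hlen : length v = preProjLength u := by
    have h := distScalar_mul_scalar u z z⁻¹
    rw [inv_mul_cancel, distScalar, Circle.coe_one, map_one, ← hz] at h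
    exact h
  have hτ : 3 / 4 < (trace (v : LG G)).re := by
    have h1 := length_sq v
    have h2 : length v ^ 2 < (1 / √2) ^ 2 := by
      rw [hlen]
      exact pow_lt_pow_left₀ hx hx0.le two_ne_zero
    rw [div_pow, Real.sq_sqrt zero_le_two] at h2
    linarith
  obtain ⟨w, g, hw, hl⟩ := hG.exists_word_length_lt v hvs hτ ε hε
  refine hw ((QuotientGroup.eq_one_iff _).mp (hbound _ (toPU_wordEval_mem v g w _ ?_ ?_) ?_))
  · rw [hvu]
    exact Subgroup.subset_closure (Set.mem_insert _ _)
  · exact Subgroup.subset_closure (Set.mem_insert_of_mem _ ⟨g, rfl⟩)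
  · exact (preProjLength_le_length _).trans_lt hl

theorem IsMIF.uniformlyDiscrete {G : Type v} [Group G] (hG : IsMIF G) :
    UniformlyDiscrete {Γ : Subgroup (PU G) | (groupToPU G).range ≤ Γ ∧ DiscreteTopology ↥Γ} := by
  refine ⟨1 / √2, by positivity, fun Γ ⟨hΓ, hdisc⟩ x hx hlt => ?_⟩
  by_contra hne
  refine hG.not_discreteTopology_closure x (projLength_pos hne) hlt ?_
  refine DiscreteTopology.of_subset (s := (Γ : Set (PU G))) hdisc
    ((Subgroup.closure_le Γ).mpr ?_)
  exact Set.insert_subset hx (by rintro _ ⟨g, rfl⟩; exact hΓ ⟨g, rfl⟩)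

end GroupVN

end

theorem mainTheorem2 {G : Type*} [Group G] (hG : GroupVN.IsMIF G) :
    (∀ u : GroupVN.PU G, 0 < GroupVN.projLength u → GroupVN.projLength u < 1 / √2 →
      ¬ DiscreteTopology
        ↥(Subgroup.closure (insert u (Set.range (GroupVN.groupToPU G))))) ∧
    GroupVN.UniformlyDiscrete
      {Γ : Subgroup (GroupVN.PU G) | (GroupVN.groupToPU G).range ≤ Γ ∧ DiscreteTopology ↥Γ} ∧
    (∀ u : unitary (GroupVN.LG G), u ∉ GroupVN.scalars G →
      3 / 4 < (GroupVN.trace (u : GroupVN.LG G)).re →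
      ∀ ε : ℝ, 0 < ε → ∃ (w : FreeGroup (Fin 2)) (g : G),
        GroupVN.wordEval u g w ∉ GroupVN.scalars G ∧
        GroupVN.length (GroupVN.wordEval u g w) < ε) :=
  ⟨hG.not_discreteTopology_closure, hG.uniformlyDiscrete, hG.exists_word_length_lt⟩
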